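/- Let $N\ge 2$, let $p_1,\dots,p_{N+1}\in\mathbb R^N$ be the vertices of a nondegenerate closed simplex $\tilde K$, let $S=\{1,\dots,N+1\}$, $\psi_i(z)=(z+p_i)/2$ for $i\in S$, and $\psi_w=\psi_{w_1}\circ\cdots\circ\psi_{w_m}$ for a finite word $w=w_1\cdots w_m$ over $S$ (with $\psi_\emptyset=\mathrm{id}$; $|w|=m$; $W_*$ is the set of all finite words). Let $K=\bigcap_{m\ge0}\bigcup_{|w|=m}\psi_w(\tilde K)$ be the $N$-dimensional Sierpinski gasket and $K_w=\psi_w(K)$. For a continuous function $f\colon K\to\mathbb R$ put $$\mathcal E_*(f)=\lim_{m\to\infty}\Bigl(\frac{N+3}{N+1}\Bigr)^m\sum_{|w|=m}\frac12\sum_{i,j\in S}\bigl(f(\psi_w(p_i))-f(\psi_w(p_j))\bigr)^2\in[0,\infty]$$ (the sequence is nondecreasing in $m$), $\mathcal F=\{f\in C(K):\mathcal E_*(f)<\infty\}$, and $\mathcal E(f,g)=\frac12\{\mathcal E_*(f+g)-\mathcal E_*(f)-\mathcal E_*(g)\}$ for $f,g\in\mathcal F$. A function $h\in\mathcal F$ is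 harmonic if $\mathcal E(h,h)\le\mathcal E(f,f)$ for every $f\in\mathcal F$ with $f(p_i)=h(p_i)$ for all $i\in S$. The energy measure $\nu_f$ of $f\in\mathcal F$ is the unique finite Borel measure on $K$ with $\int_K g\,d\nu_f=2\mathcal E(f,fg)-\mathcal E(f^2,g)$ for all $g\in\mathcal F$. The Kusuoka measure is $\nu=\sum_{k\in S}\nu_{h_k}$, where $h_k$ is the harmonic function with $h_k(p_k)=1$ and $h_k(p_i)=0$ for $i\ne k$. **Theorem.** These objects are well defined: every $u\in\mathbb R^S$ is the vector of boundary values $(h(p_i))_{i\in S}$ of exactly one harmonic function $h$, every harmonic function has exactly one energy measure, $0<\nu(K_w)<\infty$ for every $w\in W_*$, and $\nu_h$ is absolutely continuous with respect to $\nu$ for every harmonic $h$. Moreover, for every harmonic function $h$ and every $w\in W_*$, $$\inf_{w'\in W_*}\frac{\nu_h(K_{ww'})}{\nu(K_{ww'})}=0 \qquad\text{and}\qquad \nu\text{-}\operatorname*{ess\,inf}_{x\in K_w}\frac{d\nu_h}{d\nu}(x)=0 .$$ -/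

import Mathlib

open MeasureTheory
open scoped ENNReal

namespace SierpinskiGasket

/-- The ambient space `ℝ^N`. -/
abbrev Space (N : ℕ) : Type := EuclideanSpace ℝ (Fin N)

/-- Finite words over the alphabet `S`, which is modelled by `Fin (N + 1)`; the word `w w'` is
`w ++ w'`. -/
abbrev Word (N : ℕ) : Type := List (Fin (N + 1))

variable {N : ℕ}

/-- `ψ_w = ψ_{w₁} ∘ ⋯ ∘ ψ_{w_m}`, where `ψ_i z = (z + p_i) / 2`. -/
noncomputable def psi (p : Fin (N + 1) → Space N) : Word N → Space N → Space N
  | [], z => z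
  | i :: w, z => (2 : ℝ)⁻¹ • (psi p w z + p i)

/-- The closed simplex with vertices `p_i`. -/
def simplex (p : Fin (N + 1) → Space N) : Set (Space N) := convexHull ℝ (Set.range p)

/-- The Sierpinski gasket `K = ⋂_m ⋃_{|w| = m} ψ_w (simplex)`. -/
def gasket (p : Fin (N + 1) → Space N) : Set (Space N) :=
  ⋂ m : ℕ, ⋃ (w : Word N) (_ : w.length = m), psi p w '' simplex p

theorem psi_append (p : Fin (N + 1) → Space N) (v w : Word N) (z : Space N) :
    psi p (v ++ w) z = psi p v (psi p w z) := by
  induction v with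
  | nil => rfl
  | cons i v ih => simp [psi, ih]

theorem psi_replicate (p : Fin (N + 1) → Space N) (i : Fin (N + 1)) (m : ℕ) :
    psi p (List.replicate m i) (p i) = p i := by
  induction m with
  | zero => rfl
  | succ m ih =>
    rw [List.replicate_succ, psi, ih, ← two_smul ℝ (p i), smul_smul]
    norm_num

theorem psi_mem_simplex (p : Fin (N + 1) → Space N) (w : Word N) {z : Space N}
    (hz : z ∈ simplex p) : psi p w z ∈ simplex p := by
  induction w with
  | nil => exact hz
  | cons i w ih =>
    rw [psi, smul_add]
    exact convex_convexHull ℝ _ ih (subset_convexHull ℝ _ ⟨i, rfl⟩)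
      (by norm_num) (by norm_num) (by norm_num)

theorem psi_vertex_mem_gasket (p : Fin (N + 1) → Space N) (w : Word N) (i : Fin (N + 1)) :
    psi p w (p i) ∈ gasket p := by
  refine Set.mem_iInter.2 fun m => ?_
  have hlen : ((w ++ List.replicate m i).take m).length = m := by simp
  refine Set.mem_iUnion₂.2 ⟨(w ++ List.replicate m i).take m, hlen,
    psi p ((w ++ List.replicate m i).drop m) (p i),
    psi_mem_simplex p _ (subset_convexHull ℝ _ ⟨i, rfl⟩), ?_⟩
  rw [← psi_append, List.take_append_drop, psi_append, psi_replicate]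

/-- The point `ψ_w (p_i)` of `K`; these points form `V_*`, those with `|w| = m` form `V_m`. -/
noncomputable def vertex (p : Fin (N + 1) → Space N) (w : Word N) (i : Fin (N + 1)) : gasket p :=
  ⟨psi p w (p i), psi_vertex_mem_gasket p w i⟩

/-- The cell `K_w = ψ_w (K)`, as a subset of `K`. -/
def cell (p : Fin (N + 1) → Space N) (w : Word N) : Set (gasket p) :=
  {x | (x : Space N) ∈ psi p w '' gasket p}

/-- `Q_0 (u, v) = 1/2 ∑_{i,j} (u_i - u_j) (v_i - v_j)`. -/
noncomputable def Q0 (u v : Fin (N + 1) → ℝ) : ℝ :=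
  (1 / 2) * ∑ i, ∑ j, (u i - u j) * (v i - v j)

/-- `Q_m (f, g) = ∑_{|w| = m} Q_0 (f ∘ ψ_w, g ∘ ψ_w)`; only the values on `V_m` matter. -/
noncomputable def Q (p : Fin (N + 1) → Space N) (m : ℕ) (f g : gasket p → ℝ) : ℝ :=
  ∑ w : Fin m → Fin (N + 1),
    Q0 (fun i => f (vertex p (List.ofFn w) i)) (fun i => g (vertex p (List.ofFn w) i))

/-- `𝓔_* (f, f) ∈ [0, ∞]`, the limit of the nondecreasing sequence
`((N + 3) / (N + 1)) ^ m * Q_m (f, f)`, written as its supremum. -/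
noncomputable def energyStar (p : Fin (N + 1) → Space N) (f : gasket p → ℝ) : ℝ≥0∞ :=
  ⨆ m : ℕ, ENNReal.ofReal ((((N : ℝ) + 3) / ((N : ℝ) + 1)) ^ m * Q p m f f)

/-- The domain `𝓕`: continuous functions on `K` of finite energy. -/
def domain (p : Fin (N + 1) → Space N) : Set C(gasket p, ℝ) :=
  {f | energyStar p f < ∞}

/-- The bilinear form `𝓔`, meaningful on `𝓕`, obtained by polarization. -/
noncomputable def energy (p : Fin (N + 1) → Space N) (f g : C(gasket p, ℝ)) : ℝ :=
  (1 / 2) * ((energyStar p ⇑(f + g)).toReal - (energyStar p f).toReal - (energyStar p g).toReal)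

/-- The space `𝓗` of harmonic functions: the elements of `𝓕` that minimize the energy among all
elements of `𝓕` with the same values on `V_0`. -/
def harmonic (p : Fin (N + 1) → Space N) : Set C(gasket p, ℝ) :=
  {h | h ∈ domain p ∧ ∀ f ∈ domain p, (∀ i, f (vertex p [] i) = h (vertex p [] i)) →
    energy p h h ≤ energy p f f}

/-- `h` is harmonic with boundary values `u`. -/
def IsHarmonicExtension (p : Fin (N + 1) → Space N) (u : Fin (N + 1) → ℝ)
    (h : C(gasket p, ℝ)) : Prop :=
  h ∈ harmonic p ∧ ∀ i, h (vertex p [] i) = u i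

/-- `ι (u)`, the harmonic function with boundary values `u`. -/
noncomputable def harmonicExtension (p : Fin (N + 1) → Space N) (u : Fin (N + 1) → ℝ) :
    C(gasket p, ℝ) :=
  Classical.epsilon (IsHarmonicExtension p u)

/-- The defining property of the energy measure `ν_f`: a finite Borel measure on `K` with
`∫ g dν_f = 2 𝓔 (f, f g) - 𝓔 (f ^ 2, g)` for all `g ∈ 𝓕`. -/
def IsEnergyMeasure (p : Fin (N + 1) → Space N) (f : C(gasket p, ℝ))
    (ν : Measure (gasket p)) : Prop :=
  IsFiniteMeasure ν ∧
    ∀ g ∈ domain p, ∫ x, g x ∂ν = 2 * energy p f (f * g) - energy p (f ^ 2) g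

/-- The energy measure `ν_f`, the measure with the defining property above. -/
noncomputable def energyMeasure (p : Fin (N + 1) → Space N) (f : C(gasket p, ℝ)) :
    Measure (gasket p) :=
  Classical.epsilon (IsEnergyMeasure p f)

/-- The Kusuoka measure `ν = ∑_k ν_{h_k}`, where `h_k` is the harmonic function with boundary
values `e_k`. -/
noncomputable def kusuokaMeasure (p : Fin (N + 1) → Space N) : Measure (gasket p) :=
  ∑ k, energyMeasure p (harmonicExtension p (Pi.single k 1))

end SierpinskiGasket

namespace SierpinskiGasket

variable {N : ℕ}

/-! The statement reduces to linear algebra. The harmonic function with boundary values u takes at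
the vertices of K_w the values `cellMap w u`, a product of the matrices `extMap i`, and its energy
measure gives K_w the mass `cellMass u w`, which is `Q0` of these values times a factor depending
only on |w|. By Cauchy–Schwarz (`cellMass_le_sum`) a constant multiple of ν dominates each ν_h. So
the infimum of ratios vanishes once, for given u, some v makes the energy of u in suitable cells
negligible against that of v (`exists_forall_exists_Q0_cellMap_le`); the starting cell does not
matter because `cellMap w` is surjective. The essential infimum is at most the mean of the density
over any subcell, which is such a ratio (`essInf_rnDeriv_le`).

For the contraction, pass to normal derivatives x = `flux u`. There `Q0` is a multiple of the
Euclidean square norm, and `extMap i` becomes, up to a scalar, `fluxMap i`: keep x_i and replace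
every other x_j by (x_j - x_i)/(N+1). Among at least three coordinates, two, x_i and x_j, do not
have opposite signs; compare x with y = e_i - e_j. Always apply the map whose index, i or j, carries
the smaller |x|-coordinate. Then both sign patterns persist: differences are taken in x, sums in y.
The determinant x_i(-y_j) + x_j y_i is multiplied by exactly 1/(N+1), while y_i(-y_j) loses strictly
less, so x_i/y_i + x_j/(-y_j) decays geometrically and the remaining coordinates of x follow
(`Separated.step_of_le`, `Separated.exists_word`).

Existence is proved on infinite words. Energy decay in cells makes the values along an address
converge, and the limit descends to K because two addresses of one point have the form w i j j j ⋯
and w j i i i ⋯ (`exists_harmonic`). The masses `cellMass u` are additive, so they define a measure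
on sequences, whose image in K is the energy measure (`HasHarmonicValues.isEnergyMeasure`). It is
unique by Stone–Weierstrass, since harmonic functions separate points. -/

/-! ### Harmonic extension of boundary values -/

/-- The values at `ψ_i (p_j)`, `j ∈ S`, of the harmonic function with boundary values `u`. -/
noncomputable def extMap (i : Fin (N + 1)) : (Fin (N + 1) → ℝ) →ₗ[ℝ] (Fin (N + 1) → ℝ) where
  toFun u j := if j = i then u i else (u i + u j + ∑ k, u k) / ((N : ℝ) + 3)
  map_add' u v := by
    ext j
    by_cases h : j = i
    · simp [h]
    · simp only [h, if_false, Pi.add_apply, Finset.sum_add_distrib]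
      ring
  map_smul' c u := by
    ext j
    by_cases h : j = i
    · simp [h]
    · simp only [h, if_false, Pi.smul_apply, smul_eq_mul, ← Finset.mul_sum, RingHom.id_apply]
      ring

theorem extMap_apply (i j : Fin (N + 1)) (u : Fin (N + 1) → ℝ) :
    extMap i u j = if j = i then u i else (u i + u j + ∑ k, u k) / ((N : ℝ) + 3) := rfl

@[simp] theorem extMap_self (i : Fin (N + 1)) (u : Fin (N + 1) → ℝ) : extMap i u i = u i := by
  simp [extMap_apply]

theorem extMap_of_ne {i j : Fin (N + 1)} (h : j ≠ i) (u : Fin (N + 1) → ℝ) :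
    extMap i u j = (u i + u j + ∑ k, u k) / ((N : ℝ) + 3) := by
  simp [extMap_apply, h]

theorem extMap_comm (i j : Fin (N + 1)) (u : Fin (N + 1) → ℝ) :
    extMap i u j = extMap j u i := by
  by_cases h : j = i
  · rw [h]
  · rw [extMap_of_ne h, extMap_of_ne (Ne.symm h), add_comm (u i)]

/-- The values at `ψ_w (p_j)`, `j ∈ S`, of the harmonic function with boundary values `u`. -/
noncomputable def cellMap : Word N → (Fin (N + 1) → ℝ) →ₗ[ℝ] (Fin (N + 1) → ℝ)
  | [] => LinearMap.id
  | i :: w => cellMap w ∘ₗ extMap i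

@[simp] theorem cellMap_nil (u : Fin (N + 1) → ℝ) : cellMap [] u = u := rfl

@[simp] theorem cellMap_cons (i : Fin (N + 1)) (w : Word N) (u : Fin (N + 1) → ℝ) :
    cellMap (i :: w) u = cellMap w (extMap i u) := rfl

theorem cellMap_append (v w : Word N) (u : Fin (N + 1) → ℝ) :
    cellMap (v ++ w) u = cellMap w (cellMap v u) := by
  induction v generalizing u with
  | nil => rfl
  | cons i v ih => simp [ih]

/-- On the kernel u_i = 0 and every other u_j equals -s, with s the sum of all coordinates; summing
gives s = -N s, so s = 0. Invertibility lets any vector be prescribed as the vertex values on any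
cell. -/
theorem extMap_injective (i : Fin (N + 1)) : Function.Injective (extMap i) := by
  rw [injective_iff_map_eq_zero]
  intro u hu
  have h3 : (0 : ℝ) < (N : ℝ) + 3 := by positivity
  have hi : u i = 0 := by simpa using congrFun hu i
  have hj (j) : u j = if j = i then 0 else - ∑ k, u k := by
    split_ifs with h
    · rw [h, hi]
    · have := congrFun hu j
      rw [extMap_of_ne h, hi, Pi.zero_apply, div_eq_zero_iff] at this
      rcases this with h | h <;> linarith
  have hs : ∑ k, u k = 0 := by
    have : ∑ k, u k = ∑ j, if j = i then 0 else - ∑ k, u k := Finset.sum_congr rfl fun j _ => hj j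
    rw [Finset.sum_ite, Finset.filter_ne', Finset.sum_const, Finset.sum_const] at this
    simp at this
    have hN : (0 : ℝ) ≤ N := by positivity
    nlinarith
  ext j
  rw [hj j, hs]
  simp

theorem cellMap_surjective (w : Word N) : Function.Surjective (cellMap w) := by
  induction w with
  | nil => exact fun u => ⟨u, rfl⟩
  | cons i w ih =>
    exact ih.comp (LinearMap.injective_iff_surjective.1 (extMap_injective i))

/-! ### The form `Q0` and normal derivatives -/

/-- The normal derivative at `p_j` of the harmonic function with boundary values `u`. -/
def flux (u : Fin (N + 1) → ℝ) (j : Fin (N + 1)) : ℝ := ((N : ℝ) + 1) * u j - ∑ k, u k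

theorem Q0_eq (u v : Fin (N + 1) → ℝ) : Q0 u v = ∑ j, flux u j * v j := by
  have h (i j : Fin (N + 1)) : (u i - u j) * (v i - v j)
      = (u i * v i + u j * v j) - (u i * v j + u j * v i) := by ring
  have h' (j : Fin (N + 1)) : flux u j * v j
      = ((N : ℝ) + 1) * (u j * v j) - (∑ k, u k) * v j := by rw [flux]; ring
  simp only [Q0, h, h', Finset.sum_sub_distrib, Finset.sum_add_distrib,
    ← Finset.mul_sum, ← Finset.sum_mul, Finset.sum_const, Finset.card_univ, Fintype.card_fin]
  simp only [nsmul_eq_mul]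
  push_cast
  simp only [mul_left_comm (u _), ← Finset.mul_sum]
  ring

theorem Q0_comm (u v : Fin (N + 1) → ℝ) : Q0 u v = Q0 v u := by
  simp only [Q0, mul_comm]

theorem Q0_nonneg (u : Fin (N + 1) → ℝ) : 0 ≤ Q0 u u :=
  mul_nonneg (by norm_num) (Finset.sum_nonneg fun _ _ => Finset.sum_nonneg fun _ _ =>
    mul_self_nonneg _)

theorem eq_of_Q0_eq_zero {u : Fin (N + 1) → ℝ} (h : Q0 u u = 0) (i j : Fin (N + 1)) :
    u i = u j := by
  have h1 : ∑ i, ∑ j, (u i - u j) * (u i - u j) = 0 := by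
    simpa [Q0] using h
  rw [Finset.sum_eq_zero_iff_of_nonneg fun _ _ => Finset.sum_nonneg fun _ _ =>
    mul_self_nonneg _] at h1
  have h2 := h1 i (Finset.mem_univ _)
  rw [Finset.sum_eq_zero_iff_of_nonneg fun _ _ => mul_self_nonneg _] at h2
  exact sub_eq_zero.1 (mul_self_eq_zero.1 (h2 j (Finset.mem_univ _)))

theorem Q0_add_left (u u' v : Fin (N + 1) → ℝ) : Q0 (u + u') v = Q0 u v + Q0 u' v := by
  rw [Q0_comm, Q0_comm u, Q0_comm u', Q0_eq, Q0_eq, Q0_eq, ← Finset.sum_add_distrib]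
  simp [mul_add]

theorem Q0_add_right (u v v' : Fin (N + 1) → ℝ) : Q0 u (v + v') = Q0 u v + Q0 u v' := by
  rw [Q0_comm, Q0_add_left, Q0_comm v, Q0_comm v']

theorem Q0_smul_left (c : ℝ) (u v : Fin (N + 1) → ℝ) : Q0 (c • u) v = c * Q0 u v := by
  rw [Q0_comm, Q0_comm u, Q0_eq, Q0_eq, Finset.mul_sum]
  refine Finset.sum_congr rfl fun j _ => ?_
  simp only [Pi.smul_apply, smul_eq_mul]
  ring

theorem Q0_neg_left (u v : Fin (N + 1) → ℝ) : Q0 (-u) v = -Q0 u v := by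
  rw [← neg_one_smul ℝ u, Q0_smul_left, neg_one_mul]

/-- For j ≠ i the right side is antisymmetric in i and j: the normal derivatives from the two cells
meeting at ψ_i (p_j) = ψ_j (p_i) cancel. This is harmonicity at the new vertices. -/
theorem flux_extMap (i j : Fin (N + 1)) (u : Fin (N + 1) → ℝ) :
    flux (extMap i u) j = ((N : ℝ) + 1) / ((N : ℝ) + 3) *
      (if j = i then flux u i else (flux u j - flux u i) / ((N : ℝ) + 1)) := by
  have h3 : (N : ℝ) + 3 ≠ 0 := by positivity
  have h1 : (N : ℝ) + 1 ≠ 0 := by positivity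
  have hs : ∑ k, extMap i u k = ((N : ℝ) + 1) * (2 * u i + ∑ k, u k) / ((N : ℝ) + 3) := by
    have this (k : Fin (N + 1)) : extMap i u k = (u i + u k + ∑ k, u k) / ((N : ℝ) + 3)
        + if k = i then u i - (2 * u i + ∑ k, u k) / ((N : ℝ) + 3) else 0 := by
      by_cases h : k = i
      · rw [h]; simp; ring
      · simp [h, extMap_of_ne h]
    simp only [this, Finset.sum_add_distrib, ← Finset.sum_div]
    simp
    field_simp
    ring
  simp only [flux, hs]
  by_cases h : j = i
  · subst h
    simp
    field_simp
    ring
  · simp only [h, if_false, extMap_of_ne h]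
    field_simp
    ring

/-- Gluing: testing the harmonic extension of `u` against the values `F i j` at `ψ_i (p_j)`. -/
theorem sum_Q0_extMap (u : Fin (N + 1) → ℝ) {F : Fin (N + 1) → Fin (N + 1) → ℝ}
    (hF : ∀ i j, F i j = F j i) :
    ∑ i, Q0 (extMap i u) (F i) = ((N : ℝ) + 1) / ((N : ℝ) + 3) * Q0 u fun i => F i i := by
  have h (i j : Fin (N + 1)) : flux (extMap i u) j * F i j = ((N : ℝ) + 1) / ((N : ℝ) + 3) *
      ((flux u j * F i j - flux u i * F i j) / ((N : ℝ) + 1)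
        + if j = i then flux u i * F i i else 0) := by
    rw [flux_extMap]
    by_cases h : j = i
    · subst h; simp; ring
    · simp [h]; ring
  -- The fluxes are antisymmetric and `F` is symmetric, so only the corner terms `F i i` survive.
  have hz : ∑ i, ∑ j, (flux u j * F i j - flux u i * F i j) = 0 := by
    simp only [Finset.sum_sub_distrib]
    rw [sub_eq_zero, Finset.sum_comm]
    simp only [hF]
  simp only [Q0_eq, h, ← Finset.mul_sum, Finset.sum_add_distrib, ← Finset.sum_div]
  rw [hz]
  simp

theorem sum_Q0_extMap_self (u : Fin (N + 1) → ℝ) :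
    ∑ i, Q0 (extMap i u) (extMap i u) = ((N : ℝ) + 1) / ((N : ℝ) + 3) * Q0 u u := by
  rw [sum_Q0_extMap u fun i j => extMap_comm i j u]
  simp

/-- The harmonic extension minimizes the energy at the next level. -/
theorem Q0_le_sum_Q0 {F : Fin (N + 1) → Fin (N + 1) → ℝ} (hF : ∀ i j, F i j = F j i) :
    ((N : ℝ) + 1) / ((N : ℝ) + 3) * Q0 (fun i => F i i) (fun i => F i i)
      ≤ ∑ i, Q0 (F i) (F i) := by
  set u : Fin (N + 1) → ℝ := fun i => F i i
  -- Pythagoras: by `sum_Q0_extMap` the deviation from the harmonic values is orthogonal to them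
  -- after summation over the cells.
  have h (i) : Q0 (F i) (F i) = Q0 (F i + -extMap i u) (F i + -extMap i u)
      + 2 * Q0 (extMap i u) (F i) - Q0 (extMap i u) (extMap i u) := by
    rw [Q0_add_left, Q0_add_right, Q0_add_right, Q0_neg_left, Q0_comm _ (-extMap i u), Q0_neg_left,
      Q0_neg_left, Q0_comm (extMap i u) (-extMap i u), Q0_neg_left]
    ring
  have h2 := sum_Q0_extMap u hF
  have h3 := sum_Q0_extMap_self u
  have h4 : 0 ≤ ∑ i, Q0 (F i + -extMap i u) (F i + -extMap i u) :=
    Finset.sum_nonneg fun _ _ => Q0_nonneg _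
  simp only [h, Finset.sum_sub_distrib, Finset.sum_add_distrib, ← Finset.mul_sum, h2, h3]
  linarith

theorem sum_flux_sq (u : Fin (N + 1) → ℝ) : ∑ j, flux u j ^ 2 = ((N : ℝ) + 1) * Q0 u u := by
  have this (j : Fin (N + 1)) : flux u j ^ 2 = ((N : ℝ) + 1) * (flux u j * u j) - flux u j * ∑ k, u k := by
    rw [sq]; nth_rw 2 [flux]; ring
  have hs : ∑ j, flux u j = 0 := by
    simp [flux, Finset.sum_sub_distrib, ← Finset.mul_sum]
  simp only [this, Finset.sum_sub_distrib, ← Finset.mul_sum, ← Finset.sum_mul, hs, Q0_eq]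
  simp

/-- A bound for the energy in a cell: it decays at least like the square of the ratio. -/
theorem Q0_extMap_le (i : Fin (N + 1)) (u : Fin (N + 1) → ℝ) :
    Q0 (extMap i u) (extMap i u) ≤ (((N : ℝ) + 1) / ((N : ℝ) + 3)) ^ 2 * Q0 u u := by
  have h1 : (0 : ℝ) < (N : ℝ) + 1 := by positivity
  set r : ℝ := ((N : ℝ) + 1) / ((N : ℝ) + 3)
  have key : ∑ j, (if j = i then flux u i else (flux u j - flux u i) / ((N : ℝ) + 1)) ^ 2
      ≤ ∑ j, flux u j ^ 2 := by
    have hs : ∑ j, flux u j = 0 := by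
      simp [flux, Finset.sum_sub_distrib, ← Finset.mul_sum]
    have this (j : Fin (N + 1)) :
        (if j = i then flux u i else (flux u j - flux u i) / ((N : ℝ) + 1)) ^ 2
        = (flux u j ^ 2 - 2 * flux u i * flux u j + flux u i ^ 2) / ((N : ℝ) + 1) ^ 2
          + if j = i then flux u i ^ 2 else 0 := by
      by_cases h : j = i
      · subst h; simp; left; ring
      · simp only [h, if_false, div_pow, add_zero]; congr 1; ring
    -- The fluxes sum to zero, so one of them is minus the sum of the N others, and Cauchy–Schwarz
    -- applies.
    have hle : flux u i ^ 2 * ((N : ℝ) + 1) ≤ N * ∑ j, flux u j ^ 2 := by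
      have e : flux u i = -∑ j ∈ Finset.univ.erase i, flux u j := by
        rw [← Finset.add_sum_erase _ _ (Finset.mem_univ i)] at hs; linarith
      have c := sq_sum_le_card_mul_sum_sq (s := Finset.univ.erase i) (f := flux u)
      rw [Finset.card_erase_of_mem (Finset.mem_univ i)] at c
      simp only [Finset.card_univ, Fintype.card_fin, Nat.add_sub_cancel] at c
      rw [← Finset.add_sum_erase _ _ (Finset.mem_univ i)]
      have : flux u i ^ 2 ≤ N * ∑ j ∈ Finset.univ.erase i, flux u j ^ 2 := by
        rw [e, neg_sq]; exact c
      linarith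
    simp only [this, Finset.sum_add_distrib, ← Finset.sum_div, Finset.sum_sub_distrib,
      ← Finset.mul_sum, hs]
    simp
    rw [div_add' _ _ _ (by positivity), div_le_iff₀ (by positivity)]
    nlinarith [mul_le_mul_of_nonneg_left hle (by positivity : (0 : ℝ) ≤ (N : ℝ) + 2)]
  have e : ∑ j, flux (extMap i u) j ^ 2 = r ^ 2 *
      ∑ j, (if j = i then flux u i else (flux u j - flux u i) / ((N : ℝ) + 1)) ^ 2 := by
    rw [Finset.mul_sum]
    refine Finset.sum_congr rfl fun j _ => ?_
    rw [flux_extMap, mul_pow]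
  have := mul_le_mul_of_nonneg_left key (sq_nonneg r)
  rw [← e, sum_flux_sq, sum_flux_sq] at this
  nlinarith

theorem Q0_cellMap_le (w : Word N) (u : Fin (N + 1) → ℝ) :
    Q0 (cellMap w u) (cellMap w u) ≤ (((N : ℝ) + 1) / ((N : ℝ) + 3)) ^ (2 * w.length) * Q0 u u := by
  induction w generalizing u with
  | nil => simp
  | cons i w ih =>
    refine (ih _).trans ?_
    rw [List.length_cons, mul_add, pow_add, mul_assoc, mul_one]
    exact mul_le_mul_of_nonneg_left (Q0_extMap_le i u) (by positivity)

/-! ### Directions contracted by the products of the flux maps -/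

/-- The map induced by `extMap i` on fluxes, up to the factor `(N + 1) / (N + 3)`. -/
noncomputable def fluxMap (i : Fin (N + 1)) (x : Fin (N + 1) → ℝ) (j : Fin (N + 1)) : ℝ :=
  if j = i then x i else ((N : ℝ) + 1)⁻¹ * (x j - x i)

theorem fluxMap_self (i : Fin (N + 1)) (x : Fin (N + 1) → ℝ) : fluxMap i x i = x i := by
  simp [fluxMap]

theorem fluxMap_of_ne {i j : Fin (N + 1)} (h : j ≠ i) (x : Fin (N + 1) → ℝ) :
    fluxMap i x j = ((N : ℝ) + 1)⁻¹ * (x j - x i) := by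
  simp [fluxMap, h]

theorem fluxMap_neg (i : Fin (N + 1)) (x : Fin (N + 1) → ℝ) : fluxMap i (-x) = -fluxMap i x := by
  ext j
  by_cases h : j = i
  · simp [fluxMap, h]
  · simp only [fluxMap, h, if_false, Pi.neg_apply]; ring

/-- The product of the maps `fluxMap` along a word. -/
noncomputable def fluxWord : Word N → (Fin (N + 1) → ℝ) → (Fin (N + 1) → ℝ)
  | [], x => x
  | i :: w, x => fluxWord w (fluxMap i x)

theorem fluxWord_neg (w : Word N) (x : Fin (N + 1) → ℝ) : fluxWord w (-x) = -fluxWord w x := by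
  induction w generalizing x with
  | nil => rfl
  | cons i w ih => simp [fluxWord, fluxMap_neg, ih]

theorem fluxWord_append (v w : Word N) (x : Fin (N + 1) → ℝ) :
    fluxWord (v ++ w) x = fluxWord w (fluxWord v x) := by
  induction v generalizing x with
  | nil => rfl
  | cons i v ih => simp [fluxWord, ih]

theorem fluxMap_smul (i : Fin (N + 1)) (c : ℝ) (x : Fin (N + 1) → ℝ) :
    fluxMap i (c • x) = c • fluxMap i x := by
  ext j
  by_cases h : j = i
  · simp [fluxMap, h]
  · simp only [fluxMap, h, if_false, Pi.smul_apply, smul_eq_mul]; ring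

theorem fluxWord_smul (w : Word N) (c : ℝ) (x : Fin (N + 1) → ℝ) :
    fluxWord w (c • x) = c • fluxWord w x := by
  induction w generalizing x with
  | nil => rfl
  | cons i w ih => simp [fluxWord, fluxMap_smul, ih]

theorem flux_cellMap (w : Word N) (u : Fin (N + 1) → ℝ) :
    flux (cellMap w u) = (((N : ℝ) + 1) / ((N : ℝ) + 3)) ^ w.length • fluxWord w (flux u) := by
  induction w generalizing u with
  | nil => simp [fluxWord]
  | cons i w ih =>
    have : flux (extMap i u) = (((N : ℝ) + 1) / ((N : ℝ) + 3)) • fluxMap i (flux u) := by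
      ext j
      rw [flux_extMap, Pi.smul_apply, smul_eq_mul, fluxMap, div_eq_inv_mul (flux u j - flux u i)]
    rw [cellMap_cons, ih, this, fluxWord_smul, smul_smul, List.length_cons, pow_succ, fluxWord]

theorem Q0_cellMap (w : Word N) (u : Fin (N + 1) → ℝ) :
    ((N : ℝ) + 1) * Q0 (cellMap w u) (cellMap w u)
      = ((((N : ℝ) + 1) / ((N : ℝ) + 3)) ^ w.length) ^ 2 * ∑ j, fluxWord w (flux u) j ^ 2 := by
  rw [← sum_flux_sq, flux_cellMap, Finset.mul_sum]
  simp [mul_pow]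

/-! ### Contraction of a separated pair -/

/-- The pair `(x, y)` is `(e, z)`-separated in the directions `i`, `j`: the `i`- and `j`-coordinates
of `x` have the same sign, those of `y` opposite signs and comparable sizes, and `x` is small
compared with `y` in the sense measured by `e` and `z`. -/
structure Separated (i j : Fin (N + 1)) (x y : Fin (N + 1) → ℝ) (e z : ℝ) : Prop where
  xi : 0 ≤ x i
  xj : 0 ≤ x j
  yi : 0 < y i
  yj : 0 < -y j
  yij : ((N : ℝ) + 1)⁻¹ * (-y j) ≤ y i
  yji : ((N : ℝ) + 1)⁻¹ * y i ≤ -y j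
  small : x i * (-y j) + x j * y i ≤ e * (y i * (-y j))
  rest : ∀ k, k ≠ i → k ≠ j → |x k| ≤ z * (y i + -y j)

theorem Separated.swap {i j : Fin (N + 1)} {x y : Fin (N + 1) → ℝ} {e z : ℝ}
    (h : Separated i j x y e z) : Separated j i x (-y) e z where
  xi := h.xj
  xj := h.xi
  yi := h.yj
  yj := by simpa using h.yi
  yij := by simpa using h.yji
  yji := by simpa using h.yij
  small := by
    have := h.small
    simp only [Pi.neg_apply, neg_neg]
    linarith
  rest k hj hi := by
    have := h.rest k hi hj
    simp only [Pi.neg_apply, neg_neg]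
    rwa [add_comm]

/-- Put p = x_i, q = x_j, a = y_i, b = -y_j and l = 1/(N+1). The map sends (p, q) to (p, l(q - p))
and (a, b) to (a, l(a + b)), so p ≤ q is what keeps the signs. The quantity p/a + q/b is multiplied
by b/(a + b), which l b ≤ a bounds by 1/(1 + l). -/
theorem Separated.step_of_le (hN : 2 ≤ N) {i j : Fin (N + 1)} (hij : i ≠ j)
    {x y : Fin (N + 1) → ℝ} {e z : ℝ} (h : Separated i j x y e z) (hle : x i ≤ x j) :
    Separated i j (fluxMap i x) (fluxMap i y) ((1 + ((N : ℝ) + 1)⁻¹)⁻¹ * e)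
      ((1 + ((N : ℝ) + 1)⁻¹) / (2 + ((N : ℝ) + 1)⁻¹) * (z + e)) := by
  obtain ⟨xi, xj, yi, yj, yij, yji, small, rest⟩ := h
  set l : ℝ := ((N : ℝ) + 1)⁻¹ with hl
  have hl0 : 0 < l := by positivity
  have hl1 : l ≤ 1 / 3 := by
    rw [hl, inv_eq_one_div]
    apply one_div_le_one_div_of_le (by norm_num)
    have : (2 : ℝ) ≤ N := by exact_mod_cast hN
    linarith
  have e1 (v : Fin (N + 1) → ℝ) : fluxMap i v i = v i := fluxMap_self i v
  have e2 (v : Fin (N + 1) → ℝ) : fluxMap i v j = l * (v j - v i) := fluxMap_of_ne hij.symm v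
  generalize hp : x i = p at *
  generalize hq : x j = q at *
  generalize ha : y i = a at *
  generalize hb : -y j = b at *
  have hb' : y j = -b := by rw [← hb, neg_neg]
  have hab : -(l * (y j - a)) = l * (a + b) := by rw [hb']; ring
  have he : p ≤ e * a := by
    have : p * b ≤ e * a * b := by nlinarith [mul_nonneg xj yi.le]
    exact le_of_mul_le_mul_right this yj
  have he0 : 0 ≤ e := by
    by_contra hc
    push Not at hc
    nlinarith
  refine ⟨?_, ?_, ?_, ?_, ?_, ?_, ?_, ?_⟩
  · rwa [e1, hp]
  · rw [e2, hp, hq]; exact mul_nonneg hl0.le (by linarith)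
  · rwa [e1, ha]
  · rw [e2, ha, hab]; positivity
  · rw [e1, e2, ha, hab, ← hl]
    have h1 : l * (l * b) ≤ 1 / 3 * a := mul_le_mul hl1 yij (by positivity) (by norm_num)
    have h2 : l * (l * a) ≤ 1 / 3 * (1 / 3 * a) :=
      mul_le_mul hl1 (mul_le_mul_of_nonneg_right hl1 yi.le) (by positivity) (by norm_num)
    linarith
  · rw [e1, e2, ha, hab, ← hl]; nlinarith
  · rw [e1, e1, e2, e2, ha, hp, hq, hab]
    -- The left side of `small` is a 2 × 2 determinant, and the map scales it exactly by l.
    have e3 : p * (l * (a + b)) + l * (q - p) * a = l * (p * b + q * a) := by ring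
    have e4 : (1 + l)⁻¹ * e * (a * (l * (a + b))) = l * (e * a * ((1 + l)⁻¹ * (a + b))) := by ring
    rw [e3, e4]
    refine mul_le_mul_of_nonneg_left (small.trans ?_) hl0.le
    rw [← mul_assoc]
    refine mul_le_mul_of_nonneg_left ?_ (by positivity)
    rw [inv_mul_eq_div, le_div_iff₀ (by positivity)]
    linarith
  · intro k hki hkj
    rw [fluxMap_of_ne hki, e1, e2, ha, hp, hab, abs_mul, abs_of_pos hl0]
    have h1 : |x k - p| ≤ (z + e) * (a + b) := by
      have := rest k hki hkj
      have h2 := abs_sub (x k) p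
      rw [abs_of_nonneg xi] at h2
      nlinarith [mul_nonneg he0 yj.le]
    refine (mul_le_mul_of_nonneg_left h1 hl0.le).trans ?_
    have h0 : 0 ≤ (z + e) * (a + b) := (abs_nonneg _).trans h1
    have hze : 0 ≤ z + e := nonneg_of_mul_nonneg_left h0 (by positivity)
    -- After clearing denominators this is l b ≤ a.
    have h3 : l * (a + b) ≤ (1 + l) / (2 + l) * (a + l * (a + b)) := by
      rw [div_mul_eq_mul_div, le_div_iff₀ (by positivity)]
      nlinarith
    nlinarith [mul_le_mul_of_nonneg_left h3 hze]

theorem Separated.step (hN : 2 ≤ N) {i j : Fin (N + 1)} (hij : i ≠ j)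
    {x y : Fin (N + 1) → ℝ} {e z : ℝ} (h : Separated i j x y e z) :
    ∃ k, Separated i j (fluxMap k x) (fluxMap k y) ((1 + ((N : ℝ) + 1)⁻¹)⁻¹ * e)
      ((1 + ((N : ℝ) + 1)⁻¹) / (2 + ((N : ℝ) + 1)⁻¹) * (z + e)) := by
  rcases le_total (x i) (x j) with hle | hle
  · exact ⟨i, h.step_of_le hN hij hle⟩
  · refine ⟨j, ?_⟩
    simpa [fluxMap_neg] using (h.swap.step_of_le hN hij.symm hle).swap

/-- Along a suitable word the image of `x` becomes negligible compared with that of `y`. -/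
theorem Separated.exists_word (hN : 2 ≤ N) {i j : Fin (N + 1)} (hij : i ≠ j)
    {x y : Fin (N + 1) → ℝ} {e z : ℝ} (h : Separated i j x y e z) {ε : ℝ} (hε : 0 < ε) :
    ∃ w : Word N, Separated i j (fluxWord w x) (fluxWord w y) ε ε := by
  set l : ℝ := ((N : ℝ) + 1)⁻¹ with hl
  have hl0 : 0 < l := by positivity
  set θ : ℝ := (1 + l)⁻¹ with hθ
  set ρ : ℝ := (1 + l) / (2 + l) with hρ
  have hθ0 : 0 < θ := by positivity
  have hρ0 : 0 < ρ := by positivity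
  have hθ1 : θ < 1 := inv_lt_one_of_one_lt₀ (by linarith)
  have hρ1 : ρ < 1 := by rw [hρ, div_lt_one (by positivity)]; linarith
  have mono {x y : Fin (N + 1) → ℝ} {e e' z z' : ℝ} (h : Separated i j x y e z)
      (he : e ≤ e') (hz : z ≤ z') : Separated i j x y e' z' :=
    { h with
      small := h.small.trans
        (mul_le_mul_of_nonneg_right he (mul_nonneg h.yi.le h.yj.le))
      rest := fun k hi hj => (h.rest k hi hj).trans
        (mul_le_mul_of_nonneg_right hz (add_nonneg h.yi.le h.yj.le)) }
  -- the Lyapunov quantity `z + K e` decays geometrically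
  set K : ℝ := ρ * 2 / (1 - θ) with hK
  have hK0 : 0 < K := div_pos (by positivity) (by linarith)
  set κ : ℝ := max ρ ((1 + θ) / 2) with hκ
  have hκ1 : κ < 1 := max_lt hρ1 (by linarith)
  have hκ0 : 0 < κ := lt_max_of_lt_left hρ0
  have hKθ : ρ + K * θ ≤ κ * K := by
    have : ρ + K * θ = (1 + θ) / 2 * K := by
      rw [hK]; field_simp [show (1 : ℝ) - θ ≠ 0 by linarith]; ring
    rw [this]
    exact mul_le_mul_of_nonneg_right (le_max_right _ _) hK0.le
  have main (n : ℕ) : ∃ w : Word N, ∃ e' z', 0 ≤ e' ∧ 0 ≤ z' ∧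
      z' + K * e' ≤ κ ^ n * (|z| + K * |e|) ∧
      Separated i j (fluxWord w x) (fluxWord w y) e' z' := by
    induction n with
    | zero =>
      exact ⟨[], |e|, |z|, abs_nonneg _, abs_nonneg _, by simp,
        mono h (le_abs_self _) (le_abs_self _)⟩
    | succ n ih =>
      obtain ⟨w, e', z', he, hz, hle, hs⟩ := ih
      obtain ⟨k, hk⟩ := hs.step hN hij
      refine ⟨w ++ [k], θ * e', ρ * (z' + e'), by positivity, by positivity, ?_, ?_⟩
      · have h1 : ρ * z' ≤ κ * z' := mul_le_mul_of_nonneg_right (le_max_left _ _) hz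
        have h2 := mul_le_mul_of_nonneg_right hKθ he
        have h3 := mul_le_mul_of_nonneg_left hle hκ0.le
        rw [pow_succ']
        nlinarith
      · simpa [fluxWord_append, fluxWord] using hk
  obtain ⟨n, hn⟩ : ∃ n : ℕ, κ ^ n * (|z| + K * |e|) < min ε (K * ε) := by
    have ht := (tendsto_pow_atTop_nhds_zero_of_lt_one hκ0.le hκ1).mul_const (|z| + K * |e|)
    rw [zero_mul] at ht
    exact (ht.eventually_lt_const (lt_min hε (by positivity))).exists
  obtain ⟨w, e', z', he, hz, hle, hs⟩ := main n
  have h1 := hle.trans hn.le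
  refine ⟨w, mono hs ?_ ?_⟩
  · have := h1.trans (min_le_right _ _)
    exact le_of_mul_le_mul_left (by linarith) hK0
  · have := h1.trans (min_le_left _ _)
    nlinarith [mul_nonneg hK0.le he]

/-- Each coordinate of x is at most e (y_i - y_j) in absolute value, and (y_i - y_j)² ≤ 2 (y_i² +
y_j²); the other coordinates of y only help. -/
theorem Separated.sum_sq_le {i j : Fin (N + 1)} (hij : i ≠ j) {x y : Fin (N + 1) → ℝ} {e : ℝ}
    (h : Separated i j x y e e) :
    ∑ k, x k ^ 2 ≤ 2 * ((N : ℝ) + 1) * e ^ 2 * ∑ k, y k ^ 2 := by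
  obtain ⟨xi, xj, yi, yj, yij, yji, small, rest⟩ := h
  have hp : x i ≤ e * y i := by
    refine le_of_mul_le_mul_right ?_ yj
    nlinarith [mul_nonneg xj yi.le]
  have hq : x j ≤ e * (-y j) := by
    refine le_of_mul_le_mul_right ?_ yi
    nlinarith [mul_nonneg xi yj.le]
  have he : 0 ≤ e := nonneg_of_mul_nonneg_left (xi.trans hp) yi
  have hk (k) : x k ^ 2 ≤ (e * (y i + -y j)) ^ 2 := by
    rw [← sq_abs]
    refine pow_le_pow_left₀ (abs_nonneg _) ?_ 2
    by_cases hi : k = i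
    · rw [hi, abs_of_nonneg xi]; nlinarith
    by_cases hj : k = j
    · rw [hj, abs_of_nonneg xj]; nlinarith
    exact rest k hi hj
  have h1 : ∑ k, x k ^ 2 ≤ ((N : ℝ) + 1) * (e * (y i + -y j)) ^ 2 := by
    refine (Finset.sum_le_sum fun k _ => hk k).trans ?_
    simp
  have h2 : y i ^ 2 + y j ^ 2 ≤ ∑ k, y k ^ 2 := by
    rw [← Finset.sum_pair hij (f := fun k => y k ^ 2)]
    exact Finset.sum_le_sum_of_subset_of_nonneg (Finset.subset_univ _) fun _ _ _ => sq_nonneg _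
  have h3 : (e * (y i + -y j)) ^ 2 ≤ 2 * e ^ 2 * ∑ k, y k ^ 2 := by
    have : (y i + -y j) ^ 2 ≤ 2 * ∑ k, y k ^ 2 := by nlinarith [sq_nonneg (y i + y j)]
    nlinarith [mul_le_mul_of_nonneg_left this (sq_nonneg e)]
  have h4 : (0 : ℝ) ≤ (N : ℝ) + 1 := by positivity
  nlinarith [mul_le_mul_of_nonneg_left h3 h4]

/-- Three numbers cannot have pairwise opposite signs: the product of their three pairwise products
is a square. -/
theorem exists_ne_mul_nonneg (hN : 2 ≤ N) (x : Fin (N + 1) → ℝ) :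
    ∃ i j, i ≠ j ∧ 0 ≤ x i * x j := by
  by_contra! hc
  have h01 := hc ⟨0, by omega⟩ ⟨1, by omega⟩ (by simp)
  have h02 := hc ⟨0, by omega⟩ ⟨2, by omega⟩ (by simp)
  have h12 := hc ⟨1, by omega⟩ ⟨2, by omega⟩ (by simp)
  nlinarith [mul_pos_of_neg_of_neg h01 h02, sq_nonneg (x ⟨0, by omega⟩)]

/-- The energy of the harmonic function with boundary values `u` in small cells can be made
negligible compared with that of some other harmonic function. -/
theorem exists_forall_exists_Q0_cellMap_le (hN : 2 ≤ N) (u : Fin (N + 1) → ℝ) :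
    ∃ v : Fin (N + 1) → ℝ, ∀ ε > 0, ∃ w : Word N,
      Q0 (cellMap w u) (cellMap w u) ≤ ε * Q0 (cellMap w v) (cellMap w v) := by
  obtain ⟨i, j, hij, hx⟩ := exists_ne_mul_nonneg hN (flux u)
  have hN1 : (0 : ℝ) < (N : ℝ) + 1 := by positivity
  set y : Fin (N + 1) → ℝ := Pi.single i 1 - Pi.single j 1 with hy
  have yi : y i = 1 := by simp [hy, hij]
  have yj : y j = -1 := by simp [hy, hij]
  have hl1 : ((N : ℝ) + 1)⁻¹ ≤ 1 := inv_le_one_of_one_le₀ (by linarith [Nat.cast_nonneg (α := ℝ) N])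
  have sep {x : Fin (N + 1) → ℝ} (hi : 0 ≤ x i) (hj : 0 ≤ x j) :
      Separated i j x y (x i + x j) (∑ k, |x k|) := by
    refine ⟨hi, hj, by simp [yi], by simp [yj], by simpa [yi, yj], by simpa [yi, yj],
      by simp [yi, yj], fun k _ _ => ?_⟩
    have h1 := Finset.single_le_sum (f := fun k => |x k|) (fun k _ => abs_nonneg _)
      (Finset.mem_univ k)
    have h2 := abs_nonneg (x k)
    simp only [yi, yj] at h1 ⊢
    linarith
  -- On vectors of sum zero `flux` is multiplication by N + 1, hence the normalization.
  refine ⟨((N : ℝ) + 1)⁻¹ • y, fun ε hε => ?_⟩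
  have hflux : flux (((N : ℝ) + 1)⁻¹ • y) = y := by
    ext k
    simp only [flux, Pi.smul_apply, smul_eq_mul, ← Finset.mul_sum]
    have : ∑ k, y k = 0 := by simp [hy]
    rw [this, mul_zero, sub_zero, mul_inv_cancel_left₀ hN1.ne']
  set δ : ℝ := Real.sqrt (ε / (2 * ((N : ℝ) + 1))) with hδ
  have hδ0 : 0 < δ := Real.sqrt_pos.2 (by positivity)
  have hδ2 : 2 * ((N : ℝ) + 1) * δ ^ 2 = ε := by
    rw [hδ, Real.sq_sqrt (by positivity)]; field_simp
  obtain ⟨w, hw⟩ : ∃ w : Word N,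
      ∑ k, fluxWord w (flux u) k ^ 2 ≤ ε * ∑ k, fluxWord w y k ^ 2 := by
    rcases mul_nonneg_iff.1 hx with ⟨hi, hj⟩ | ⟨hi, hj⟩
    · obtain ⟨w, hw⟩ := (sep hi hj).exists_word hN hij hδ0
      exact ⟨w, hδ2 ▸ hw.sum_sq_le hij⟩
    -- Both coordinates are nonpositive here; changing the sign of x leaves its square norm
    -- unchanged.
    · obtain ⟨w, hw⟩ := (sep (x := -flux u) (by simpa) (by simpa)).exists_word hN hij hδ0
      have := hw.sum_sq_le hij
      rw [hδ2, fluxWord_neg] at this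
      exact ⟨w, by simpa using this⟩
  refine ⟨w, le_of_mul_le_mul_left ?_ hN1⟩
  rw [Q0_cellMap, mul_left_comm, Q0_cellMap, hflux, mul_left_comm]
  exact mul_le_mul_of_nonneg_left hw (sq_nonneg _)

/-! ### Sequences -/

/-- Infinite words over the alphabet `S`. -/
abbrev Seq (N : ℕ) : Type := ℕ → Fin (N + 1)

/-- The prefix of length `n`. -/
def pre (n : ℕ) (ω : Seq N) : Word N := List.ofFn fun k : Fin n => ω k

/-- The sequence without its first letter. -/
def tail (ω : Seq N) : Seq N := fun n => ω (n + 1)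

/-- The sequence without its first `n` letters. -/
def dropSeq (n : ℕ) (ω : Seq N) : Seq N := fun k => ω (n + k)

/-- The word `w` followed by `i i i ⋯`. -/
def padded (w : Word N) (i : Fin (N + 1)) : Seq N := fun n => w.getD n i

@[simp] theorem length_pre (n : ℕ) (ω : Seq N) : (pre n ω).length = n := by simp [pre]

@[simp] theorem pre_zero (ω : Seq N) : pre 0 ω = [] := by simp [pre]

theorem pre_succ (n : ℕ) (ω : Seq N) : pre (n + 1) ω = ω 0 :: pre n (tail ω) := by
  simp [pre, tail, List.ofFn_succ]

theorem pre_succ_last (n : ℕ) (ω : Seq N) : pre (n + 1) ω = pre n ω ++ [ω n] := by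
  rw [pre, List.ofFn_succ_last]
  rfl

theorem pre_eq_pre_iff {n : ℕ} {ω ω' : Seq N} : pre n ω = pre n ω' ↔ ∀ k < n, ω k = ω' k := by
  rw [pre, pre, List.ofFn_inj, funext_iff]
  exact ⟨fun h k hk => h ⟨k, hk⟩, fun h k => h k k.2⟩

theorem dropSeq_succ (n : ℕ) (ω : Seq N) : dropSeq (n + 1) ω = dropSeq n (tail ω) := by
  ext k
  simp only [dropSeq, tail]
  rw [Nat.add_right_comm]

@[simp] theorem dropSeq_zero (ω : Seq N) : dropSeq 0 ω = ω := by
  ext k; simp [dropSeq]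

theorem padded_nil (i : Fin (N + 1)) : padded [] i = fun _ => i := by
  ext; simp [padded]

@[simp] theorem padded_cons_zero (j : Fin (N + 1)) (w : Word N) (i : Fin (N + 1)) :
    padded (j :: w) i 0 = j := rfl

@[simp] theorem tail_padded_cons (j : Fin (N + 1)) (w : Word N) (i : Fin (N + 1)) :
    tail (padded (j :: w) i) = padded w i := by
  ext; simp [padded, tail]

theorem pre_padded (w : Word N) (i : Fin (N + 1)) : pre w.length (padded w i) = w := by
  induction w with
  | nil => simp
  | cons j w ih => rw [List.length_cons, pre_succ, tail_padded_cons, ih, padded_cons_zero]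

theorem padded_pre {n : ℕ} {ω : Seq N} {i : Fin (N + 1)} (h : ∀ k, n ≤ k → ω k = i) :
    padded (pre n ω) i = ω := by
  ext k
  rw [padded]
  rcases lt_or_ge k n with hk | hk
  · rw [List.getD_eq_getElem _ _ (by simpa)]
    simp [pre]
  · rw [List.getD_eq_default _ _ (by simpa), h k hk]

/-- The sequence `w` followed by `ω`. -/
def appendSeq : Word N → Seq N → Seq N
  | [], ω => ω
  | i :: w, ω => fun n => Nat.casesOn n i (appendSeq w ω)

@[simp] theorem appendSeq_cons_zero (i : Fin (N + 1)) (w : Word N) (ω : Seq N) :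
    appendSeq (i :: w) ω 0 = i := rfl

@[simp] theorem tail_appendSeq_cons (i : Fin (N + 1)) (w : Word N) (ω : Seq N) :
    tail (appendSeq (i :: w) ω) = appendSeq w ω := rfl

theorem pre_appendSeq (w : Word N) (ω : Seq N) : pre w.length (appendSeq w ω) = w := by
  induction w with
  | nil => simp
  | cons j w ih => rw [List.length_cons, pre_succ, tail_appendSeq_cons, ih, appendSeq_cons_zero]

/-- Sequences which are eventually constant. -/
def eventuallyConst (N : ℕ) : Set (Seq N) := {ω | ∃ n i, ∀ k, n ≤ k → ω k = i}

theorem countable_eventuallyConst : (eventuallyConst N).Countable := by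
  refine (Set.countable_range fun x : Word N × Fin (N + 1) => padded x.1 x.2).mono ?_
  rintro ω ⟨n, i, h⟩
  exact ⟨(pre n ω, i), padded_pre h⟩

/-! ### The coding map -/

/-- The point of the gasket with address `ω`. -/
noncomputable def coding (p : Fin (N + 1) → Space N) (ω : Seq N) : Space N :=
  ∑' n, (2⁻¹ : ℝ) ^ (n + 1) • p (ω n)

theorem summable_bound (C : ℝ) : Summable fun n : ℕ => (2⁻¹ : ℝ) ^ (n + 1) * C :=
  ((summable_nat_add_iff 1).2
    (summable_geometric_of_lt_one (by norm_num) (by norm_num))).mul_right C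

theorem norm_term_le (p : Fin (N + 1) → Space N) (n : ℕ) (i : Fin (N + 1)) :
    ‖(2⁻¹ : ℝ) ^ (n + 1) • p i‖ ≤ (2⁻¹ : ℝ) ^ (n + 1) * ∑ i, ‖p i‖ := by
  rw [norm_smul, norm_pow, norm_inv, Real.norm_two]
  exact mul_le_mul_of_nonneg_left (Finset.single_le_sum (f := fun i => ‖p i‖)
    (fun i _ => norm_nonneg _) (Finset.mem_univ i)) (by positivity)

theorem continuous_coding (p : Fin (N + 1) → Space N) : Continuous (coding p) := by
  refine continuous_tsum (fun n => ?_) (summable_bound _) fun n ω => norm_term_le p n (ω n)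
  have h : Continuous fun ω : Seq N => ω n := continuous_apply n
  exact ((continuous_of_discreteTopology (f := p)).comp h).const_smul ((2⁻¹ : ℝ) ^ (n + 1))

theorem coding_eq (p : Fin (N + 1) → Space N) (ω : Seq N) :
    coding p ω = (2 : ℝ)⁻¹ • (coding p (tail ω) + p (ω 0)) := by
  have hs : Summable fun n => (2⁻¹ : ℝ) ^ (n + 1) • p (ω n) :=
    (summable_bound _).of_norm_bounded fun n => norm_term_le p n (ω n)
  rw [coding, hs.tsum_eq_zero_add, coding, smul_add, ← tsum_const_smul'', add_comm]
  simp [tail, smul_smul, pow_succ']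

theorem coding_eq_psi (p : Fin (N + 1) → Space N) (n : ℕ) (ω : Seq N) :
    coding p ω = psi p (pre n ω) (coding p (dropSeq n ω)) := by
  induction n generalizing ω with
  | zero => simp [psi]
  | succ n ih => rw [pre_succ, psi, dropSeq_succ, ← ih, ← coding_eq]

theorem coding_appendSeq (p : Fin (N + 1) → Space N) (w : Word N) (ω : Seq N) :
    coding p (appendSeq w ω) = psi p w (coding p ω) := by
  induction w with
  | nil => rfl
  | cons i w ih => rw [coding_eq, tail_appendSeq_cons, ih]; rfl

theorem dist_psi (p : Fin (N + 1) → Space N) (w : Word N) (x y : Space N) :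
    dist (psi p w x) (psi p w y) = 2⁻¹ ^ w.length * dist x y := by
  induction w with
  | nil => simp [psi]
  | cons i w ih =>
    rw [psi, psi, dist_smul₀, dist_add_right, ih, norm_inv, Real.norm_two, List.length_cons,
      pow_succ', mul_assoc]

theorem psi_injective (p : Fin (N + 1) → Space N) (w : Word N) : Function.Injective (psi p w) := by
  intro x y h
  have := dist_psi p w x y
  rw [h, dist_self, eq_comm, mul_eq_zero] at this
  exact dist_eq_zero.1 (this.resolve_left (by positivity))

theorem isCompact_simplex (p : Fin (N + 1) → Space N) : IsCompact (simplex p) :=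
  (Set.finite_range p).isCompact_convexHull ℝ

theorem vertex_mem_simplex (p : Fin (N + 1) → Space N) (i : Fin (N + 1)) : p i ∈ simplex p :=
  subset_convexHull ℝ _ ⟨i, rfl⟩

theorem tendsto_half_pow_mul (C : ℝ) :
    Filter.Tendsto (fun n : ℕ => (2⁻¹ : ℝ) ^ n * C) Filter.atTop (nhds 0) := by
  simpa using (tendsto_pow_atTop_nhds_zero_of_lt_one (r := (2⁻¹ : ℝ))
    (by norm_num) (by norm_num)).mul_const C

theorem coding_mem_simplex (p : Fin (N + 1) → Space N) (ω : Seq N) : coding p ω ∈ simplex p := by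
  obtain ⟨C, hC⟩ : ∃ C, ∀ ω, dist (p 0) (coding p ω) ≤ C := by
    have : IsCompact (Set.range (coding p)) := isCompact_range (continuous_coding p)
    obtain ⟨C, hC⟩ := this.isBounded.subset_closedBall (p 0)
    exact ⟨C, fun ω => by simpa [dist_comm] using hC ⟨ω, rfl⟩⟩
  refine (isCompact_simplex p).isClosed.mem_of_tendsto (b := Filter.atTop)
    (f := fun n => psi p (pre n ω) (p 0)) ?_
    (Filter.Eventually.of_forall fun n => psi_mem_simplex p _ (vertex_mem_simplex p 0))
  rw [tendsto_iff_dist_tendsto_zero]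
  refine squeeze_zero (fun _ => dist_nonneg) (fun n => ?_) (tendsto_half_pow_mul C)
  rw [coding_eq_psi p n ω, dist_psi, length_pre]
  exact mul_le_mul_of_nonneg_left (hC _) (by positivity)

theorem coding_mem_gasket (p : Fin (N + 1) → Space N) (ω : Seq N) : coding p ω ∈ gasket p :=
  Set.mem_iInter.2 fun m => Set.mem_iUnion₂.2 ⟨pre m ω, length_pre m ω,
    coding p (dropSeq m ω), coding_mem_simplex p _, (coding_eq_psi p m ω).symm⟩

/-- The coding map onto the gasket. -/
noncomputable def code (p : Fin (N + 1) → Space N) (ω : Seq N) : gasket p :=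
  ⟨coding p ω, coding_mem_gasket p ω⟩

theorem continuous_code (p : Fin (N + 1) → Space N) : Continuous (code p) :=
  (continuous_coding p).subtype_mk _

theorem coding_const (p : Fin (N + 1) → Space N) (i : Fin (N + 1)) :
    coding p (fun _ => i) = p i := by
  have : coding p (fun _ => i) = (2 : ℝ)⁻¹ • (coding p (fun _ => i) + p i) := by
    conv_lhs => rw [coding_eq]
    rfl
  rw [smul_add, ← sub_eq_iff_eq_add'] at this
  have h2 : coding p (fun _ => i) - (2 : ℝ)⁻¹ • coding p (fun _ => i)
      = (2 : ℝ)⁻¹ • coding p (fun _ => i) := by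
    module
  rw [h2] at this
  exact smul_right_injective _ (by norm_num : (2 : ℝ)⁻¹ ≠ 0) this

theorem code_padded (p : Fin (N + 1) → Space N) (w : Word N) (i : Fin (N + 1)) :
    code p (padded w i) = vertex p w i := by
  refine Subtype.ext ?_
  change coding p _ = psi p w (p i)
  induction w with
  | nil => rw [padded_nil, coding_const]; rfl
  | cons j w ih => rw [coding_eq, tail_padded_cons, ih]; rfl

theorem dist_vertex_le (p : Fin (N + 1) → Space N) (n : ℕ) (ω : Seq N) (i : Fin (N + 1)) :
    dist (vertex p (pre n ω) i) (code p ω) ≤ 2⁻¹ ^ n * Metric.diam (simplex p) := by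
  change dist (psi p (pre n ω) (p i)) (coding p ω) ≤ _
  rw [coding_eq_psi p n ω, dist_psi, length_pre]
  exact mul_le_mul_of_nonneg_left (Metric.dist_le_diam_of_mem (isCompact_simplex p).isBounded
    (vertex_mem_simplex p i) (coding_mem_simplex p _)) (by positivity)

theorem exists_dist_vertex_lt (p : Fin (N + 1) → Space N) (x : gasket p) {ε : ℝ} (hε : 0 < ε) :
    ∃ w : Word N, dist (vertex p w 0) x < ε := by
  obtain ⟨n, hn⟩ := ((tendsto_half_pow_mul (Metric.diam (simplex p))).eventually_lt_const hε).exists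
  obtain ⟨w, hw, y, hy, hyx⟩ := Set.mem_iUnion₂.1 (Set.mem_iInter.1 x.2 n)
  refine ⟨w, lt_of_le_of_lt ?_ hn⟩
  change dist (psi p w (p 0)) x.1 ≤ _
  rw [← hyx, dist_psi, hw]
  exact mul_le_mul_of_nonneg_left (Metric.dist_le_diam_of_mem (isCompact_simplex p).isBounded
    (vertex_mem_simplex p 0) hy) (by positivity)

theorem dense_range_vertex (p : Fin (N + 1) → Space N) :
    Dense (Set.range fun w : Word N => vertex p w 0) := by
  rw [Metric.dense_iff]
  intro x ε hε
  obtain ⟨w, hw⟩ := exists_dist_vertex_lt p x hε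
  exact ⟨_, hw, w, rfl⟩

/-- The range is compact and contains the dense set of vertices, whose addresses are the padded
words. -/
theorem surjective_code (p : Fin (N + 1) → Space N) : Function.Surjective (code p) := by
  have hsub : (Set.range fun w : Word N => vertex p w 0) ⊆ Set.range (code p) := by
    rintro _ ⟨w, rfl⟩
    exact ⟨padded w 0, code_padded p w 0⟩
  rw [← Set.range_eq_univ, ← (isCompact_range (continuous_code p)).isClosed.closure_eq]
  exact ((dense_range_vertex p).mono hsub).closure_eq

instance (p : Fin (N + 1) → Space N) : CompactSpace (gasket p) :=
  (surjective_code p).compactSpace (continuous_code p)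

/-! ### Fibres of the coding map -/

theorem exists_barycentric {p : Fin (N + 1) → Space N} (hp : AffineIndependent ℝ p) :
    ∃ β : Fin (N + 1) → Space N → ℝ,
      (∀ j x y, β j ((2 : ℝ)⁻¹ • (x + y)) = (β j x + β j y) / 2) ∧
      (∀ i j, β j (p i) = if j = i then 1 else 0) ∧
      (∀ x ∈ simplex p, ∀ j, 0 ≤ β j x) ∧ ∀ x, ∑ j, β j x = 1 := by
  have htot : affineSpan ℝ (Set.range p) = ⊤ := by
    rw [hp.affineSpan_eq_top_iff_card_eq_finrank_add_one]
    simp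
  let b : AffineBasis (Fin (N + 1)) ℝ (Space N) := ⟨p, hp, htot⟩
  have hb (i j) : b.coord j (p i) = if j = i then 1 else 0 := b.coord_apply j i
  refine ⟨fun j x => b.coord j x, fun j x y => ?_, hb, fun x hx j => ?_, b.sum_coord_apply_eq_one⟩
  · have : (2 : ℝ)⁻¹ • (x + y) = midpoint ℝ x y := by
      rw [midpoint_eq_smul_add, invOf_eq_inv]
    change b.coord j _ = _
    rw [this, AffineMap.map_midpoint, midpoint_eq_smul_add, invOf_eq_inv, smul_eq_mul]
    ring
  · have hx' : x ∈ convexHull ℝ (Set.range b) := hx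
    rw [b.convexHull_eq_nonneg_coord] at hx'
    exact hx' j

/-- The j-th coordinate at ω is the mean of the one at the tail and of 0 or 1, according to the
first letter. Both are at most 1, so a mean of 1 forces the first letter to be j and reproduces the
hypothesis for the tail. -/
theorem eq_const_of_barycentric {p : Fin (N + 1) → Space N} {β : Fin (N + 1) → Space N → ℝ}
    (hmid : ∀ j x y, β j ((2 : ℝ)⁻¹ • (x + y)) = (β j x + β j y) / 2)
    (hv : ∀ i j, β j (p i) = if j = i then 1 else 0) (hnn : ∀ x ∈ simplex p, ∀ j, 0 ≤ β j x)
    (hsum : ∀ x, ∑ j, β j x = 1) {ω : Seq N} {j : Fin (N + 1)} (h : β j (coding p ω) = 1) :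
    ω = fun _ => j := by
  have hle (ω : Seq N) : β j (coding p ω) ≤ 1 := by
    rw [← hsum (coding p ω)]
    exact Finset.single_le_sum (f := fun j => β j (coding p ω))
      (fun j _ => hnn _ (coding_mem_simplex p ω) j) (Finset.mem_univ j)
  have step (ω : Seq N) (hω : β j (coding p ω) = 1) :
      ω 0 = j ∧ β j (coding p (tail ω)) = 1 := by
    rw [coding_eq, hmid, hv] at hω
    have := hle (tail ω)
    split_ifs at hω with hj
    · exact ⟨hj.symm, by linarith⟩
    · linarith
  have main (n : ℕ) : ∀ ω : Seq N, β j (coding p ω) = 1 → ω n = j := by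
    induction n with
    | zero => exact fun ω hω => (step ω hω).1
    | succ n ih => exact fun ω hω => ih (tail ω) (step ω hω).2
  funext n
  exact main n ω h

/-- A point in two first-level cells has two barycentric coordinates that are at least 1/2, hence
equal to 1/2; doubling, the tail of ω codes the vertex with index `ω' 0`. -/
theorem tail_eq_of_coding_eq {p : Fin (N + 1) → Space N} (hp : AffineIndependent ℝ p) {ω ω' : Seq N}
    (h : coding p ω = coding p ω') (h0 : ω 0 ≠ ω' 0) : tail ω = fun _ => ω' 0 := by
  obtain ⟨β, hmid, hv, hnn, hsum⟩ := exists_barycentric hp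
  apply eq_const_of_barycentric hmid hv hnn hsum
  have hi : β (ω 0) (coding p ω) = (β (ω 0) (coding p (tail ω)) + 1) / 2 := by
    rw [coding_eq, hmid, hv, if_pos rfl]
  have hj : β (ω' 0) (coding p ω) = (β (ω' 0) (coding p (tail ω')) + 1) / 2 := by
    rw [h, coding_eq, hmid, hv, if_pos rfl]
  have hj' : β (ω' 0) (coding p ω) = β (ω' 0) (coding p (tail ω)) / 2 := by
    rw [coding_eq, hmid, hv, if_neg h0.symm, add_zero]
  have hle : β (ω 0) (coding p ω) + β (ω' 0) (coding p ω) ≤ 1 := by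
    rw [← hsum (coding p ω), ← Finset.sum_pair h0 (f := fun j => β j (coding p ω))]
    exact Finset.sum_le_sum_of_subset_of_nonneg (Finset.subset_univ _)
      fun j _ _ => hnn _ (coding_mem_simplex p ω) j
  have h1 := hnn _ (coding_mem_simplex p (tail ω)) (ω 0)
  have h2 := hnn _ (coding_mem_simplex p (tail ω')) (ω' 0)
  linarith

theorem exists_of_coding_eq {p : Fin (N + 1) → Space N} (hp : AffineIndependent ℝ p) {ω ω' : Seq N}
    (h : coding p ω = coding p ω') (hne : ω ≠ ω') :
    ∃ n, pre n ω = pre n ω' ∧ tail (dropSeq n ω) = (fun _ => ω' n) ∧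
      tail (dropSeq n ω') = fun _ => ω n := by
  have hex : ∃ n, ω n ≠ ω' n := by
    by_contra! hc
    exact hne (funext hc)
  classical
  refine ⟨Nat.find hex, ?_, ?_⟩
  · rw [pre_eq_pre_iff]
    intro k hk
    simpa using Nat.find_min hex hk
  · have hpre : pre (Nat.find hex) ω = pre (Nat.find hex) ω' := by
      rw [pre_eq_pre_iff]
      intro k hk
      simpa using Nat.find_min hex hk
    have hn := Nat.find_spec hex
    generalize Nat.find hex = n at *
    have hc : coding p (dropSeq n ω) = coding p (dropSeq n ω') := by
      apply psi_injective p (pre n ω)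
      rw [← coding_eq_psi, h, hpre, ← coding_eq_psi]
    exact ⟨tail_eq_of_coding_eq hp hc hn, tail_eq_of_coding_eq hp hc.symm hn.symm⟩

/-! ### Sums over the words of given length -/

/-- The sum of `F w` over the words `w` of length `m`. -/
noncomputable def levelSum (m : ℕ) (F : Word N → ℝ) : ℝ :=
  ∑ w : Fin m → Fin (N + 1), F (List.ofFn w)

@[simp] theorem levelSum_zero (F : Word N → ℝ) : levelSum 0 F = F [] := by
  simp [levelSum]

theorem levelSum_succ (m : ℕ) (F : Word N → ℝ) :
    levelSum (m + 1) F = ∑ i, levelSum m fun w => F (i :: w) := by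
  simp only [levelSum]
  rw [← (Fin.consEquiv fun _ => Fin (N + 1)).sum_comp, Fintype.sum_prod_type]
  simp [Fin.consEquiv, List.ofFn_succ]

theorem levelSum_succ_last (m : ℕ) (F : Word N → ℝ) :
    levelSum (m + 1) F = levelSum m fun w => ∑ i, F (w ++ [i]) := by
  induction m generalizing F with
  | zero => simp [levelSum_succ]
  | succ m ih =>
    rw [levelSum_succ, levelSum_succ]
    exact Finset.sum_congr rfl fun i _ => ih fun w => F (i :: w)

theorem levelSum_congr {m : ℕ} {F G : Word N → ℝ} (h : ∀ w, w.length = m → F w = G w) :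
    levelSum m F = levelSum m G :=
  Finset.sum_congr rfl fun w _ => h _ (by simp)

theorem levelSum_mono {m : ℕ} {F G : Word N → ℝ} (h : ∀ w, w.length = m → F w ≤ G w) :
    levelSum m F ≤ levelSum m G :=
  Finset.sum_le_sum fun w _ => h _ (by simp)

theorem levelSum_nonneg {m : ℕ} {F : Word N → ℝ} (h : ∀ w, 0 ≤ F w) : 0 ≤ levelSum m F :=
  Finset.sum_nonneg fun _ _ => h _

theorem levelSum_add (m : ℕ) (F G : Word N → ℝ) :
    levelSum m (fun w => F w + G w) = levelSum m F + levelSum m G :=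
  Finset.sum_add_distrib

theorem levelSum_sub (m : ℕ) (F G : Word N → ℝ) :
    levelSum m (fun w => F w - G w) = levelSum m F - levelSum m G :=
  Finset.sum_sub_distrib ..

theorem levelSum_mul (m : ℕ) (c : ℝ) (F : Word N → ℝ) :
    levelSum m (fun w => c * F w) = c * levelSum m F :=
  (Finset.mul_sum ..).symm

theorem abs_levelSum_le (m : ℕ) (F : Word N → ℝ) :
    |levelSum m F| ≤ levelSum m fun w => |F w| :=
  Finset.abs_sum_le_sum_abs ..

/-! ### Energies at finite levels -/

variable {p : Fin (N + 1) → Space N}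

/-- The values of `f` at the vertices of the cell `K_w`. -/
noncomputable def cellValues (p : Fin (N + 1) → Space N) (f : gasket p → ℝ) (w : Word N)
    (i : Fin (N + 1)) : ℝ := f (vertex p w i)

/-- The renormalized energy at level `m`. -/
noncomputable def energyAt (p : Fin (N + 1) → Space N) (m : ℕ) (f g : gasket p → ℝ) : ℝ :=
  (((N : ℝ) + 3) / ((N : ℝ) + 1)) ^ m * levelSum m fun w => Q0 (cellValues p f w) (cellValues p g w)

theorem vertex_append_comm (w : Word N) (i j : Fin (N + 1)) :
    vertex p (w ++ [i]) j = vertex p (w ++ [j]) i := by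
  refine Subtype.ext ?_
  change psi p _ _ = psi p _ _
  rw [psi_append, psi_append]
  simp [psi, add_comm]

theorem vertex_append_self (w : Word N) (i : Fin (N + 1)) :
    vertex p (w ++ [i]) i = vertex p w i := by
  refine Subtype.ext ?_
  change psi p _ _ = psi p _ _
  rw [psi_append]
  congr 1
  simpa using psi_replicate p i 1

theorem energyAt_nonneg (m : ℕ) (f : gasket p → ℝ) : 0 ≤ energyAt p m f f :=
  mul_nonneg (by positivity) (levelSum_nonneg fun _ => Q0_nonneg _)

theorem ratio_cancel (m : ℕ) (x : ℝ) :
    (((N : ℝ) + 3) / ((N : ℝ) + 1)) ^ (m + 1) * (((N : ℝ) + 1) / ((N : ℝ) + 3) * x)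
      = (((N : ℝ) + 3) / ((N : ℝ) + 1)) ^ m * x := by
  have h1 : (N : ℝ) + 1 ≠ 0 := by positivity
  have h3 : (N : ℝ) + 3 ≠ 0 := by positivity
  rw [pow_succ]
  field_simp

theorem energyAt_le_succ (m : ℕ) (f : gasket p → ℝ) :
    energyAt p m f f ≤ energyAt p (m + 1) f f := by
  rw [energyAt, energyAt, levelSum_succ_last, ← ratio_cancel, ← levelSum_mul]
  refine mul_le_mul_of_nonneg_left (levelSum_mono fun w _ => ?_) (by positivity)
  refine le_trans (le_of_eq ?_)
    (Q0_le_sum_Q0 (F := fun i => cellValues p f (w ++ [i])) fun i j => ?_)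
  · have : (fun i => cellValues p f (w ++ [i]) i) = cellValues p f w :=
      funext fun i => by rw [cellValues, vertex_append_self, cellValues]
    rw [this]
  · rw [cellValues, vertex_append_comm, cellValues]

theorem monotone_energyAt (f : gasket p → ℝ) : Monotone fun m => energyAt p m f f :=
  monotone_nat_of_le_succ fun m => energyAt_le_succ m f

theorem mem_domain_iff (f : C(gasket p, ℝ)) :
    f ∈ domain p ↔ ∃ C, ∀ m, energyAt p m f f ≤ C := by
  constructor
  · intro h
    refine ⟨(energyStar p f).toReal, fun m => ?_⟩
    rw [← ENNReal.ofReal_le_iff_le_toReal (ne_of_lt h)]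
    exact le_iSup (fun m => ENNReal.ofReal (energyAt p m f f)) m
  · rintro ⟨C, hC⟩
    exact (iSup_le fun m => ENNReal.ofReal_le_ofReal (hC m)).trans_lt ENNReal.ofReal_lt_top

theorem tendsto_energyAt_self {f : C(gasket p, ℝ)} (hf : f ∈ domain p) :
    Filter.Tendsto (fun m => energyAt p m f f) Filter.atTop (nhds (energyStar p f).toReal) := by
  have h := tendsto_atTop_iSup (f := fun m => ENNReal.ofReal (energyAt p m f f))
    fun m n hmn => ENNReal.ofReal_le_ofReal (monotone_energyAt f hmn)
  have h2 := (ENNReal.tendsto_toReal (ne_of_lt hf)).comp h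
  refine h2.congr fun m => ?_
  exact ENNReal.toReal_ofReal (energyAt_nonneg m f)

theorem energyAt_comm (m : ℕ) (f g : gasket p → ℝ) : energyAt p m f g = energyAt p m g f := by
  simp only [energyAt, Q0_comm]

theorem energyAt_add_left (m : ℕ) (f f' g : gasket p → ℝ) :
    energyAt p m (f + f') g = energyAt p m f g + energyAt p m f' g := by
  rw [energyAt, energyAt, energyAt, ← mul_add, ← levelSum_add]
  exact congrArg _ (levelSum_congr fun w _ => Q0_add_left _ _ _)

theorem energyAt_neg_left (m : ℕ) (f g : gasket p → ℝ) :
    energyAt p m (-f) g = -energyAt p m f g := by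
  have h := energyAt_add_left m f (-f) g
  have h0 := energyAt_add_left m (0 : gasket p → ℝ) 0 g
  rw [add_neg_cancel] at h
  rw [add_zero] at h0
  linarith

theorem energyAt_add_self (m : ℕ) (f g : gasket p → ℝ) :
    energyAt p m (f + g) (f + g)
      = energyAt p m f f + energyAt p m g g + 2 * energyAt p m f g := by
  rw [energyAt_add_left, energyAt_comm m f, energyAt_comm m g, energyAt_add_left,
    energyAt_add_left, energyAt_comm m g f]
  ring

theorem energyAt_neg_right (m : ℕ) (f g : gasket p → ℝ) :
    energyAt p m f (-g) = -energyAt p m f g := by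
  rw [energyAt_comm, energyAt_neg_left, energyAt_comm]

theorem energyAt_sub_self (m : ℕ) (f g : gasket p → ℝ) :
    energyAt p m (f - g) (f - g)
      = energyAt p m f f + energyAt p m g g - 2 * energyAt p m f g := by
  rw [sub_eq_add_neg, energyAt_add_self, energyAt_neg_left, energyAt_neg_right, energyAt_neg_right]
  ring

theorem add_mem_domain {f g : C(gasket p, ℝ)} (hf : f ∈ domain p) (hg : g ∈ domain p) :
    f + g ∈ domain p := by
  rw [mem_domain_iff] at *
  obtain ⟨C, hC⟩ := hf
  obtain ⟨D, hD⟩ := hg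
  refine ⟨2 * C + 2 * D, fun m => ?_⟩
  have h := energyAt_nonneg m (f - g : gasket p → ℝ)
  rw [energyAt_sub_self] at h
  rw [ContinuousMap.coe_add, energyAt_add_self]
  linarith [hC m, hD m]

theorem const_mem_domain (c : ℝ) : ContinuousMap.const (gasket p) c ∈ domain p := by
  rw [mem_domain_iff]
  refine ⟨0, fun m => le_of_eq ?_⟩
  simp [energyAt, levelSum, cellValues, Q0]

theorem mul_mem_domain {f g : C(gasket p, ℝ)} (hf : f ∈ domain p) (hg : g ∈ domain p) :
    f * g ∈ domain p := by
  rw [mem_domain_iff] at *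
  obtain ⟨C, hC⟩ := hf
  obtain ⟨D, hD⟩ := hg
  refine ⟨2 * ‖f‖ ^ 2 * D + 2 * ‖g‖ ^ 2 * C, fun m => ?_⟩
  have h : energyAt p m (f * g : C(gasket p, ℝ)) (f * g : C(gasket p, ℝ))
      ≤ 2 * ‖f‖ ^ 2 * energyAt p m g g + 2 * ‖g‖ ^ 2 * energyAt p m f f := by
    rw [energyAt, energyAt, energyAt, mul_left_comm, mul_left_comm (2 * ‖g‖ ^ 2), ← mul_add,
      ← levelSum_mul (c := 2 * ‖f‖ ^ 2), ← levelSum_mul (c := 2 * ‖g‖ ^ 2), ← levelSum_add]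
    refine mul_le_mul_of_nonneg_left (levelSum_mono fun w _ => ?_) (by positivity)
    simp only [Q0, Finset.mul_sum, ← Finset.sum_add_distrib]
    refine Finset.sum_le_sum fun i _ => Finset.sum_le_sum fun j _ => ?_
    simp only [cellValues, ContinuousMap.mul_apply]
    have hi : f (vertex p w i) ^ 2 ≤ ‖f‖ ^ 2 := by
      rw [← sq_abs]; exact pow_le_pow_left₀ (abs_nonneg _) (f.norm_coe_le_norm _) 2
    have hj : g (vertex p w j) ^ 2 ≤ ‖g‖ ^ 2 := by
      rw [← sq_abs]; exact pow_le_pow_left₀ (abs_nonneg _) (g.norm_coe_le_norm _) 2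
    have h1 := mul_le_mul_of_nonneg_right hi (sq_nonneg (g (vertex p w i) - g (vertex p w j)))
    have h2 := mul_le_mul_of_nonneg_right hj (sq_nonneg (f (vertex p w i) - f (vertex p w j)))
    generalize f (vertex p w i) = a at *
    generalize f (vertex p w j) = b at *
    generalize g (vertex p w i) = c at *
    generalize g (vertex p w j) = d at *
    -- Here a c - b d = a (c - d) + d (a - b), and (s + t)² ≤ 2 s² + 2 t².
    nlinarith [sq_nonneg (a * (c - d) - d * (a - b))]
  refine h.trans (add_le_add (mul_le_mul_of_nonneg_left (hD m) (by positivity))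
    (mul_le_mul_of_nonneg_left (hC m) (by positivity)))

theorem tendsto_energyAt {f g : C(gasket p, ℝ)} (hf : f ∈ domain p) (hg : g ∈ domain p) :
    Filter.Tendsto (fun m => energyAt p m f g) Filter.atTop (nhds (energy p f g)) := by
  have h := (((tendsto_energyAt_self (add_mem_domain hf hg)).sub
    (tendsto_energyAt_self hf)).sub (tendsto_energyAt_self hg)).const_mul (1 / 2)
  refine h.congr fun m => ?_
  rw [ContinuousMap.coe_add, energyAt_add_self]
  ring

theorem energyAt_le_energy {f : C(gasket p, ℝ)} (hf : f ∈ domain p) (m : ℕ) :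
    energyAt p m f f ≤ energy p f f :=
  (monotone_energyAt f).ge_of_tendsto (tendsto_energyAt hf hf) m

/-- Vanishing energy makes f constant on the vertices of each cell; a cell shares a vertex with its
parent, so the value 0 spreads from the boundary to a dense set. -/
theorem eq_zero_of_energyAt_le_zero {f : C(gasket p, ℝ)} (h : ∀ m, energyAt p m f f ≤ 0)
    (h0 : ∀ i, f (vertex p [] i) = 0) : f = 0 := by
  have hconst (w : Word N) (i j) : f (vertex p w i) = f (vertex p w j) := by
    have hm := h w.length
    rw [energyAt] at hm
    have h1 : levelSum w.length (fun w => Q0 (cellValues p f w) (cellValues p f w)) ≤ 0 :=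
      nonpos_of_mul_nonpos_right hm (by positivity)
    have h2 := Finset.single_le_sum (f := fun v : Fin w.length → Fin (N + 1) =>
      Q0 (cellValues p f (List.ofFn v)) (cellValues p f (List.ofFn v)))
      (fun _ _ => Q0_nonneg _) (Finset.mem_univ w.get)
    simp only [List.ofFn_get] at h2
    exact eq_of_Q0_eq_zero (le_antisymm (h2.trans h1) (Q0_nonneg _)) i j
  have hv (w : Word N) : ∀ i, f (vertex p w i) = 0 := by
    induction w using List.reverseRecOn with
    | nil => exact h0
    | append_singleton w i ih =>
      intro j
      rw [hconst _ j i, vertex_append_self, ih]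
  refine ContinuousMap.coe_injective
    (Continuous.ext_on (dense_range_vertex p) f.continuous continuous_const ?_)
  rintro _ ⟨w, rfl⟩
  exact hv w 0

/-! ### Functions with harmonic values -/

/-- The values of `f` at all the vertices are those of the harmonic extension of `u`. -/
def HasHarmonicValues (p : Fin (N + 1) → Space N) (u : Fin (N + 1) → ℝ) (f : gasket p → ℝ) : Prop :=
  ∀ w, cellValues p f w = cellMap w u

/-- By gluing in every cell (`sum_Q0_extMap`), the pairing with any g does not depend on the level.
Finite energy, minimality and uniqueness all follow from this. -/
theorem HasHarmonicValues.energyAt_eq {u : Fin (N + 1) → ℝ} {f : gasket p → ℝ}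
    (hf : HasHarmonicValues p u f) (m : ℕ) (g : gasket p → ℝ) :
    energyAt p m f g = Q0 u (cellValues p g []) := by
  induction m with
  | zero => simp [energyAt, hf []]
  | succ m ih =>
    rw [← ih, energyAt, energyAt, levelSum_succ_last, ← ratio_cancel m,
      ← levelSum_mul (c := ((N : ℝ) + 1) / ((N : ℝ) + 3))]
    refine congrArg _ (levelSum_congr fun w _ => ?_)
    have h := sum_Q0_extMap (cellMap w u) (F := fun i => cellValues p g (w ++ [i]))
      fun i j => by rw [cellValues, vertex_append_comm, cellValues]
    have h2 : (fun i => cellValues p g (w ++ [i]) i) = cellValues p g w :=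
      funext fun i => by rw [cellValues, vertex_append_self, cellValues]
    rw [h2] at h
    rw [hf w, ← h]
    refine Finset.sum_congr rfl fun i _ => ?_
    rw [hf, cellMap_append]
    rfl

theorem HasHarmonicValues.mem_domain {u : Fin (N + 1) → ℝ} {h : C(gasket p, ℝ)}
    (hh : HasHarmonicValues p u h) : h ∈ domain p :=
  (mem_domain_iff h).2 ⟨_, fun m => (hh.energyAt_eq m h).le⟩

theorem HasHarmonicValues.energy_eq {u : Fin (N + 1) → ℝ} {h : C(gasket p, ℝ)}
    (hh : HasHarmonicValues p u h) : energy p h h = Q0 u u := by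
  refine tendsto_nhds_unique (tendsto_energyAt hh.mem_domain hh.mem_domain) ?_
  simp only [hh.energyAt_eq _ h, hh [], cellMap_nil]
  exact tendsto_const_nhds

theorem HasHarmonicValues.isHarmonicExtension {u : Fin (N + 1) → ℝ} {h : C(gasket p, ℝ)}
    (hh : HasHarmonicValues p u h) : IsHarmonicExtension p u h := by
  refine ⟨⟨hh.mem_domain, fun f hf hfh => ?_⟩, fun i => congrFun (hh []) i⟩
  refine le_trans (le_of_eq ?_) (energyAt_le_energy hf 0)
  rw [hh.energy_eq]
  have : cellValues p f [] = u := by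
    funext i
    rw [cellValues, hfh]
    exact congrFun (hh []) i
  simp [energyAt, this]

theorem HasHarmonicValues.eq_of_isHarmonicExtension {u : Fin (N + 1) → ℝ} {h f : C(gasket p, ℝ)}
    (hh : HasHarmonicValues p u h) (hf : IsHarmonicExtension p u f) : f = h := by
  have hfu : cellValues p f [] = u := funext hf.2
  have hle := hf.1.2 h hh.mem_domain fun i => by
    rw [hf.2]
    exact congrFun (hh []) i
  rw [hh.energy_eq] at hle
  rw [← sub_eq_zero]
  refine eq_zero_of_energyAt_le_zero (fun m => ?_) fun i => ?_
  -- The energy of f - h at level m is that of f plus `Q0 u u` minus twice the cross term, which is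
  -- again `Q0 u u`; minimality of f bounds the total by 0.
  · have h1 := (energyAt_le_energy hf.1.1 m).trans hle
    rw [ContinuousMap.coe_sub, energyAt_sub_self, energyAt_comm m (f : gasket p → ℝ) h, hh.energyAt_eq, hh.energyAt_eq, hfu, hh [], cellMap_nil]
    linarith
  · rw [ContinuousMap.sub_apply, hf.2, sub_eq_zero]
    exact (congrFun (hh []) i).symm

/-- Discrete carré du champ: each pair contributes (h_i - h_j)² (g_i + g_j), which is then
symmetrized. -/
theorem two_mul_Q0_mul_sub (h g : Fin (N + 1) → ℝ) :
    2 * Q0 h (h * g) - Q0 (h ^ 2) g = ∑ i, (∑ j, (h i - h j) ^ 2) * g i := by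
  have hsymm : ∑ i, ∑ j, (h i - h j) ^ 2 * g j = ∑ i, ∑ j, (h i - h j) ^ 2 * g i := by
    rw [Finset.sum_comm]
    exact Finset.sum_congr rfl fun i _ => Finset.sum_congr rfl fun j _ => by ring
  have key : ∑ i, ∑ j, (2 * ((h i - h j) * (h i * g i - h j * g j))
      - (h i ^ 2 - h j ^ 2) * (g i - g j))
      = ∑ i, ∑ j, ((h i - h j) ^ 2 * g i + (h i - h j) ^ 2 * g j) :=
    Finset.sum_congr rfl fun i _ => Finset.sum_congr rfl fun j _ => by ring
  simp only [Finset.sum_add_distrib, Finset.sum_sub_distrib, ← Finset.mul_sum, hsymm] at key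
  simp only [Q0, Pi.mul_apply, Pi.pow_apply, Finset.sum_mul]
  linarith

/-! ### Construction of harmonic functions -/

theorem pre_add (n m : ℕ) (ω : Seq N) : pre (n + m) ω = pre n ω ++ pre m (dropSeq n ω) := by
  induction n generalizing ω with
  | zero => simp
  | succ n ih => rw [Nat.add_right_comm, pre_succ, pre_succ, ih, dropSeq_succ, List.cons_append]

theorem continuous_comp_pre {X : Type*} [TopologicalSpace X] (n : ℕ) (F : Word N → X) :
    Continuous fun ω : Seq N => F (pre n ω) := by
  have h : Continuous fun (ω : Seq N) (k : Fin n) => ω k :=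
    continuous_pi fun k => continuous_apply (k : ℕ)
  exact (continuous_of_discreteTopology (f := fun v : Fin n → Fin (N + 1) => F (List.ofFn v))).comp h

/-- The ratio `(N + 1) / (N + 3)`. -/
noncomputable def ratio (N : ℕ) : ℝ := ((N : ℝ) + 1) / ((N : ℝ) + 3)

theorem ratio_pos : 0 < ratio N := by unfold ratio; positivity

theorem ratio_lt_one : ratio N < 1 := by
  rw [ratio, div_lt_one (by positivity)]
  linarith

theorem sq_sub_le_Q0 (u : Fin (N + 1) → ℝ) (i j : Fin (N + 1)) : (u i - u j) ^ 2 ≤ Q0 u u := by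
  rcases eq_or_ne i j with rfl | hij
  · simpa using Q0_nonneg u
  have h (k) : 0 ≤ ∑ l, (u k - u l) * (u k - u l) :=
    Finset.sum_nonneg fun _ _ => mul_self_nonneg _
  have h1 : ∑ k ∈ {i, j}, ∑ l, (u k - u l) * (u k - u l) ≤ ∑ k, ∑ l, (u k - u l) * (u k - u l) :=
    Finset.sum_le_sum_of_subset_of_nonneg (Finset.subset_univ _) fun k _ _ => h k
  rw [Finset.sum_pair hij] at h1
  have h2 := Finset.single_le_sum (f := fun l => (u i - u l) * (u i - u l))
    (fun _ _ => mul_self_nonneg _) (Finset.mem_univ j)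
  have h3 := Finset.single_le_sum (f := fun l => (u j - u l) * (u j - u l))
    (fun _ _ => mul_self_nonneg _) (Finset.mem_univ i)
  rw [Q0]
  nlinarith

theorem abs_cellMap_sub_le (w : Word N) (u : Fin (N + 1) → ℝ) (i j : Fin (N + 1)) :
    |cellMap w u i - cellMap w u j| ≤ ratio N ^ w.length * Real.sqrt (Q0 u u) := by
  apply abs_le_of_sq_le_sq _ (mul_nonneg (pow_nonneg ratio_pos.le _) (Real.sqrt_nonneg _))
  rw [mul_pow, Real.sq_sqrt (Q0_nonneg u), ← pow_mul, mul_comm w.length]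
  exact (sq_sub_le_Q0 _ i j).trans (Q0_cellMap_le w u)

theorem cellMap_append_singleton (w : Word N) (k : Fin (N + 1)) (u : Fin (N + 1) → ℝ) :
    cellMap (w ++ [k]) u = extMap k (cellMap w u) := by
  rw [cellMap_append]; rfl

theorem abs_cellMap_append_sub_le (w : Word N) (u : Fin (N + 1) → ℝ) (k i j : Fin (N + 1)) :
    |cellMap (w ++ [k]) u i - cellMap w u j|
      ≤ ratio N ^ w.length * (2 * Real.sqrt (Q0 u u)) := by
  have h1 := abs_cellMap_sub_le (w ++ [k]) u i k
  have h2 := abs_cellMap_sub_le w u k j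
  have h3 : cellMap (w ++ [k]) u k = cellMap w u k := by
    rw [cellMap_append_singleton, extMap_self]
  rw [h3] at h1
  have h4 := abs_sub_le (cellMap (w ++ [k]) u i) (cellMap w u k) (cellMap w u j)
  have h5 : ratio N ^ (w ++ [k]).length * Real.sqrt (Q0 u u)
      ≤ ratio N ^ w.length * Real.sqrt (Q0 u u) :=
    mul_le_mul_of_nonneg_right (pow_le_pow_of_le_one ratio_pos.le ratio_lt_one.le (by simp))
      (Real.sqrt_nonneg _)
  linarith

/-- The value at the point with address `ω` of the harmonic function with boundary values `u`. -/
noncomputable def harmonicValue (u : Fin (N + 1) → ℝ) (ω : Seq N) : ℝ :=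
  u 0 + ∑' n, (cellMap (pre (n + 1) ω) u 0 - cellMap (pre n ω) u 0)

theorem summable_ratio (C : ℝ) : Summable fun n : ℕ => ratio N ^ n * C :=
  (summable_geometric_of_lt_one ratio_pos.le ratio_lt_one).mul_right C

theorem norm_harmonicValue_term_le (u : Fin (N + 1) → ℝ) (n : ℕ) (ω : Seq N) :
    ‖cellMap (pre (n + 1) ω) u 0 - cellMap (pre n ω) u 0‖
      ≤ ratio N ^ n * (2 * Real.sqrt (Q0 u u)) := by
  have := abs_cellMap_append_sub_le (pre n ω) u (ω n) 0 0
  rwa [length_pre, ← pre_succ_last] at this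

theorem continuous_harmonicValue (u : Fin (N + 1) → ℝ) : Continuous (harmonicValue u) := by
  refine continuous_const.add (continuous_tsum (fun n => ?_) (summable_ratio _)
    (norm_harmonicValue_term_le u))
  exact (continuous_comp_pre (n + 1) fun w => cellMap w u 0).sub
    (continuous_comp_pre n fun w => cellMap w u 0)

theorem tendsto_cellMap_pre (u : Fin (N + 1) → ℝ) (ω : Seq N) (k : Fin (N + 1)) :
    Filter.Tendsto (fun n => cellMap (pre n ω) u k) Filter.atTop (nhds (harmonicValue u ω)) := by
  have hs : Summable fun n => cellMap (pre (n + 1) ω) u 0 - cellMap (pre n ω) u 0 :=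
    (summable_ratio _).of_norm_bounded fun n => norm_harmonicValue_term_le u n ω
  have h0 : Filter.Tendsto (fun n => cellMap (pre n ω) u 0) Filter.atTop
      (nhds (harmonicValue u ω)) := by
    refine (hs.hasSum.tendsto_sum_nat.const_add (u 0)).congr fun n => ?_
    rw [Finset.sum_range_sub fun n => cellMap (pre n ω) u 0]
    simp
  have h1 : Filter.Tendsto (fun n => cellMap (pre n ω) u k - cellMap (pre n ω) u 0) Filter.atTop
      (nhds 0) := by
    refine squeeze_zero_norm (fun n => ?_) (summable_ratio (N := N)
      (Real.sqrt (Q0 u u))).tendsto_atTop_zero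
    have := abs_cellMap_sub_le (pre n ω) u k 0
    rwa [length_pre] at this
  simpa using h1.add h0

theorem harmonicValue_dropSeq (u : Fin (N + 1) → ℝ) (n : ℕ) (ω : Seq N) :
    harmonicValue u ω = harmonicValue (cellMap (pre n ω) u) (dropSeq n ω) := by
  refine tendsto_nhds_unique ?_ (tendsto_cellMap_pre _ _ 0)
  simp only [← cellMap_append, ← pre_add]
  exact (Filter.tendsto_add_atTop_iff_nat n).2 (tendsto_cellMap_pre u ω 0) |>.congr
    fun m => by rw [add_comm m n]

theorem harmonicValue_tail (u : Fin (N + 1) → ℝ) (ω : Seq N) :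
    harmonicValue u ω = harmonicValue (extMap (ω 0) u) (tail ω) := by
  have h := harmonicValue_dropSeq u 1 ω
  rw [dropSeq_succ, dropSeq_zero, pre_succ, pre_zero] at h
  exact h

theorem harmonicValue_const (u : Fin (N + 1) → ℝ) (i : Fin (N + 1)) :
    harmonicValue u (fun _ => i) = u i := by
  refine tendsto_nhds_unique (tendsto_cellMap_pre u _ i) ?_
  have (n : ℕ) : cellMap (pre n fun _ => i) u i = u i := by
    induction n with
    | zero => simp
    | succ n ih => rw [pre_succ_last, cellMap_append_singleton, extMap_self, ih]
  simp only [this]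
  exact tendsto_const_nhds

theorem harmonicValue_padded (u : Fin (N + 1) → ℝ) (w : Word N) (i : Fin (N + 1)) :
    harmonicValue u (padded w i) = cellMap w u i := by
  induction w generalizing u with
  | nil => rw [padded_nil, harmonicValue_const]; rfl
  | cons j w ih => rw [harmonicValue_tail, tail_padded_cons, ih]; rfl

/-- The two addresses are w i j j ⋯ and w j i i ⋯, so the values are entries (i, j) and (j, i) of
the symmetric array `extMap`. -/
theorem harmonicValue_eq_of_coding_eq {p : Fin (N + 1) → Space N} (hp : AffineIndependent ℝ p)
    (u : Fin (N + 1) → ℝ) {ω ω' : Seq N} (h : coding p ω = coding p ω') :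
    harmonicValue u ω = harmonicValue u ω' := by
  rcases eq_or_ne ω ω' with rfl | hne
  · rfl
  obtain ⟨n, hpre, h1, h2⟩ := exists_of_coding_eq hp h hne
  rw [harmonicValue_dropSeq u n ω, harmonicValue_dropSeq u n ω', hpre, harmonicValue_tail, h1,
    harmonicValue_tail _ (dropSeq n ω'), h2, harmonicValue_const, harmonicValue_const]
  exact extMap_comm _ _ _

theorem exists_harmonic {p : Fin (N + 1) → Space N} (hp : AffineIndependent ℝ p)
    (u : Fin (N + 1) → ℝ) :
    ∃ h : C(gasket p, ℝ), HasHarmonicValues p u h ∧ ∀ ω, h (code p ω) = harmonicValue u ω := by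
  have hq : Topology.IsQuotientMap (⟨code p, continuous_code p⟩ : C(Seq N, gasket p)) :=
    Topology.IsQuotientMap.of_surjective_continuous (surjective_code p) (continuous_code p)
  let g : C(Seq N, ℝ) := ⟨harmonicValue u, continuous_harmonicValue u⟩
  have hg : Function.FactorsThrough g (⟨code p, continuous_code p⟩ : C(Seq N, gasket p)) :=
    fun a b hab => harmonicValue_eq_of_coding_eq hp u (congrArg Subtype.val hab)
  have hcode (ω : Seq N) : hq.lift g hg (code p ω) = harmonicValue u ω :=
    DFunLike.congr_fun (hq.lift_comp g hg) ω
  refine ⟨hq.lift g hg, fun w => funext fun i => ?_, hcode⟩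
  rw [cellValues, ← code_padded, hcode, harmonicValue_padded]

/-! ### Harmonic functions separate points -/

theorem le_extMap {c : ℝ} {u : Fin (N + 1) → ℝ} (hu : ∀ i, c ≤ u i) (k i : Fin (N + 1)) :
    c ≤ extMap k u i := by
  rcases eq_or_ne i k with rfl | h
  · simpa using hu i
  · rw [extMap_of_ne h, le_div_iff₀ (by positivity)]
    have : ∑ _j : Fin (N + 1), c ≤ ∑ j, u j := Finset.sum_le_sum fun j _ => hu j
    simp at this
    linarith [hu k, hu i]

theorem le_harmonicValue {c : ℝ} {u : Fin (N + 1) → ℝ} (hu : ∀ i, c ≤ u i) (ω : Seq N) :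
    c ≤ harmonicValue u ω := by
  refine ge_of_tendsto' (tendsto_cellMap_pre u ω 0) fun n => ?_
  have (w : Word N) : ∀ {u : Fin (N + 1) → ℝ}, (∀ i, c ≤ u i) → ∀ i, c ≤ cellMap w u i := by
    induction w with
    | nil => exact fun hu => hu
    | cons k w ih => exact fun hu => ih (le_extMap hu k)
  exact this _ hu 0

theorem harmonicValue_pos {u : Fin (N + 1) → ℝ} (hu : ∀ i, 0 < u i) (ω : Seq N) :
    0 < harmonicValue u ω := by
  obtain ⟨k, hk⟩ := Finite.exists_min u
  exact (hu k).trans_le (le_harmonicValue hk ω)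

theorem harmonicValue_neg (u : Fin (N + 1) → ℝ) (ω : Seq N) :
    harmonicValue (-u) ω = -harmonicValue u ω := by
  refine tendsto_nhds_unique (tendsto_cellMap_pre _ _ 0) ?_
  simpa using (tendsto_cellMap_pre u ω 0).neg

/-- Strong minimum principle: in a first-level cell other than the j-th all corner values are
positive, and in the j-th cell the hypotheses on u recur. -/
theorem eq_const_of_harmonicValue_eq_zero {j : Fin (N + 1)} {u : Fin (N + 1) → ℝ} {ω : Seq N}
    (hj : u j = 0) (hpos : ∀ i, i ≠ j → 0 < u i) (h : harmonicValue u ω = 0) : ω = fun _ => j := by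
  have hnn {u : Fin (N + 1) → ℝ} (hj : u j = 0) (hpos : ∀ i, i ≠ j → 0 < u i) (k) : 0 ≤ u k := by
    rcases eq_or_ne k j with rfl | hk
    exacts [hj.ge, (hpos k hk).le]
  have step {u : Fin (N + 1) → ℝ} {ω : Seq N} (hj : u j = 0) (hpos : ∀ i, i ≠ j → 0 < u i)
      (h : harmonicValue u ω = 0) : ω 0 = j := by
    by_contra hne
    rw [harmonicValue_tail] at h
    refine (harmonicValue_pos (fun l => ?_) (tail ω)).ne' h
    rcases eq_or_ne l (ω 0) with rfl | hl
    · simpa using hpos _ hne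
    · rw [extMap_of_ne hl]
      have := hpos _ hne
      have := hnn hj hpos l
      have := Finset.sum_nonneg fun k (_ : k ∈ Finset.univ) => hnn hj hpos k
      positivity
  have main (n : ℕ) : ∀ {u : Fin (N + 1) → ℝ} {ω : Seq N}, u j = 0 → (∀ i, i ≠ j → 0 < u i) →
      harmonicValue u ω = 0 → ω n = j := by
    induction n with
    | zero => exact fun hj hpos h => step hj hpos h
    | succ n ih =>
      intro u ω hj hpos h
      have h0 := step hj hpos h
      rw [harmonicValue_tail, h0] at h
      refine ih (ω := tail ω) (by simpa using hj) (fun l hl => ?_) h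
      rw [extMap_of_ne hl]
      have := hpos l hl
      have := Finset.sum_nonneg fun k (_ : k ∈ Finset.univ) => hnn hj hpos k
      rw [hj]
      positivity
  exact funext fun n => main n hj hpos h

/-- Suppose that, after the common prefix, the letters i ≠ j differ. The harmonic function with
boundary values e_i - e_j is nonnegative on cell i and nonpositive on cell j, and vanishes there
only at their common point, so equal values force both addresses to code that point. -/
theorem coding_eq_of_harmonicValue_eq (p : Fin (N + 1) → Space N) {ω ω' : Seq N}
    (h : ∀ u, harmonicValue u ω = harmonicValue u ω') : coding p ω = coding p ω' := by
  by_contra hne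
  have hex : ∃ n, ω n ≠ ω' n := by
    by_contra! hc
    exact hne (congrArg _ (funext hc))
  classical
  have hpre : pre (Nat.find hex) ω = pre (Nat.find hex) ω' := by
    rw [pre_eq_pre_iff]
    intro k hk
    simpa using Nat.find_min hex hk
  have hn := Nat.find_spec hex
  generalize Nat.find hex = n at *
  rw [coding_eq_psi p n ω, coding_eq_psi p n ω', hpre] at hne
  have hdrop (v) : harmonicValue v (dropSeq n ω) = harmonicValue v (dropSeq n ω') := by
    obtain ⟨u, rfl⟩ := cellMap_surjective (pre n ω) v
    have := h u
    rwa [harmonicValue_dropSeq u n ω, harmonicValue_dropSeq u n ω', ← hpre] at this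
  change dropSeq n ω 0 ≠ dropSeq n ω' 0 at hn
  generalize dropSeq n ω = η at *
  generalize dropSeq n ω' = η' at *
  have key {i j : Fin (N + 1)} (hij : i ≠ j) : extMap i (Pi.single i 1 - Pi.single j 1) j = 0 ∧
      ∀ k, k ≠ j → 0 < extMap i (Pi.single i 1 - Pi.single j 1) k := by
    constructor
    · rw [extMap_of_ne hij.symm]
      simp [hij, hij.symm]
    · intro k hk
      rcases eq_or_ne k i with rfl | hki
      · simp [hij]
      · rw [extMap_of_ne hki]
        simp [hij, hk, hki]
        positivity
  have hnn {i j : Fin (N + 1)} (hij : i ≠ j) (ω : Seq N) :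
      0 ≤ harmonicValue (extMap i (Pi.single i 1 - Pi.single j 1)) ω := by
    refine le_harmonicValue (fun k => ?_) ω
    rcases eq_or_ne k j with rfl | hk
    exacts [(key hij).1.ge, ((key hij).2 k hk).le]
  have h1 := hdrop (Pi.single (η 0) 1 - Pi.single (η' 0) 1)
  have h2 := harmonicValue_neg (Pi.single (η 0) 1 - Pi.single (η' 0) 1) η'
  rw [neg_sub, harmonicValue_tail] at h2
  rw [harmonicValue_tail] at h1
  have h3 := hnn hn (tail η)
  have h4 := hnn hn.symm (tail η')
  have t1 := eq_const_of_harmonicValue_eq_zero (key hn).1 (key hn).2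
    (ω := tail η) (by linarith)
  have t2 := eq_const_of_harmonicValue_eq_zero (key hn.symm).1 (key hn.symm).2
    (ω := tail η') (by linarith)
  apply hne
  rw [coding_eq p η, coding_eq p η', t1, t2, coding_const, coding_const, add_comm]

/-! ### Measures on sequences with prescribed masses of cylinders -/

/-- The sequences starting with `w`. -/
def cylinder (w : Word N) : Set (Seq N) := {ω | pre w.length ω = w}

theorem mem_cylinder {w : Word N} {ω : Seq N} : ω ∈ cylinder w ↔ pre w.length ω = w := Iff.rfl

theorem mem_cylinder_pre (n : ℕ) (ω : Seq N) : ω ∈ cylinder (pre n ω) := by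
  rw [mem_cylinder, length_pre]

theorem isClopen_cylinder (w : Word N) : IsClopen (cylinder w) := by
  have h := continuous_comp_pre w.length fun v : Word N => decide (v = w)
  have h2 : cylinder w = (fun ω : Seq N => decide (pre w.length ω = w)) ⁻¹' {true} := by
    ext ω; simp [mem_cylinder]
  rw [h2]
  exact (isClopen_discrete _).preimage h

theorem measurableSet_cylinder (w : Word N) : MeasurableSet (cylinder w) :=
  (isClopen_cylinder w).isOpen.measurableSet

theorem comp_pre_eq_sum (n : ℕ) (F : Word N → ℝ) (ω : Seq N) :
    F (pre n ω) = ∑ w : Fin n → Fin (N + 1),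
      (cylinder (List.ofFn w)).indicator (fun _ => F (List.ofFn w)) ω := by
  rw [Finset.sum_eq_single fun k : Fin n => ω k]
  · rw [Set.indicator_of_mem]
    · rfl
    · exact mem_cylinder_pre n ω
  · intro w _ hw
    rw [Set.indicator_of_notMem]
    intro hω
    rw [mem_cylinder, List.length_ofFn] at hω
    exact hw (List.ofFn_injective hω).symm
  · simp

theorem integral_comp_pre {μ : Measure (Seq N)} [IsFiniteMeasure μ] {m : Word N → ℝ}
    (hm : ∀ w, 0 ≤ m w) (hμ : ∀ w, μ (cylinder w) = ENNReal.ofReal (m w)) (n : ℕ) (F : Word N → ℝ) :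
    ∫ ω, F (pre n ω) ∂μ = levelSum n fun w => m w * F w := by
  simp only [comp_pre_eq_sum n F]
  rw [integral_finsetSum]
  · refine Finset.sum_congr rfl fun w _ => ?_
    rw [integral_indicator_const _ (measurableSet_cylinder _), measureReal_def, hμ,
      ENNReal.toReal_ofReal (hm _), smul_eq_mul]
  · exact fun w _ => (integrable_const _).indicator (measurableSet_cylinder _)

/-- Riemann sums converge to the integral. -/
theorem tendsto_levelSum_integral {μ : Measure (Seq N)} [IsFiniteMeasure μ] {m : Word N → ℝ}
    (hm : ∀ w, 0 ≤ m w) (hμ : ∀ w, μ (cylinder w) = ENNReal.ofReal (m w)) {g : Seq N → ℝ}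
    (hg : Integrable g μ) {G : Word N → ℝ}
    (hG : ∀ ε > 0, ∀ᶠ n in Filter.atTop, ∀ ω, |G (pre n ω) - g ω| ≤ ε) :
    Filter.Tendsto (fun n => levelSum n fun w => m w * G w) Filter.atTop (nhds (∫ ω, g ω ∂μ)) := by
  rw [Metric.tendsto_atTop']
  intro ε hε
  have hpos : 0 < μ.real Set.univ + 1 := by positivity
  obtain ⟨n, hn⟩ := Filter.eventually_atTop.1 (hG (ε / (μ.real Set.univ + 1)) (by positivity))
  refine ⟨n, fun k hk => ?_⟩
  rw [← integral_comp_pre hm hμ, Real.dist_eq, ← integral_sub _ hg]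
  · have h := norm_integral_le_of_norm_le_const (μ := μ)
      (f := fun ω => G (pre k ω) - g ω) (Filter.Eventually.of_forall fun ω => hn k hk.le ω)
    rw [Real.norm_eq_abs] at h
    refine h.trans_lt ?_
    rw [div_mul_eq_mul_div, div_lt_iff₀ hpos]
    nlinarith [measureReal_nonneg (μ := μ) (s := Set.univ)]
  · exact (continuous_comp_pre k G).integrable_of_hasCompactSupport (HasCompactSupport.of_compactSpace _)

theorem pre_padded_append (k : ℕ) (w : Word N) (h : k ≤ w.length) (v : Word N)
    (i : Fin (N + 1)) : pre k (padded (w ++ v) i) = pre k (padded w i) := by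
  rw [pre_eq_pre_iff]
  intro l hl
  rw [padded, padded, List.getD_append _ _ _ _ (by omega)]

theorem levelSum_add_pre {m : Word N → ℝ} (hadd : ∀ w, m w = ∑ i, m (w ++ [i])) (k n : ℕ)
    (F : Word N → ℝ) :
    levelSum (k + n) (fun w => m w * F (pre k (padded w 0))) = levelSum k fun w => m w * F w := by
  induction n with
  | zero =>
    refine levelSum_congr fun w hw => ?_
    have hk : k = w.length := by omega
    rw [hk, pre_padded]
  | succ n ih =>
    rw [← ih, ← add_assoc, levelSum_succ_last]
    refine levelSum_congr fun w hw => ?_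
    rw [hadd w, Finset.sum_mul]
    exact Finset.sum_congr rfl fun i _ => by rw [pre_padded_append k w (by omega)]

/-- Put an atom of mass m w in each cylinder of level n and take a weak limit along an ultrafilter.
By additivity the mass of a fixed cylinder is eventually constant in n, and it passes to the limit
because its indicator is continuous. -/
theorem exists_measure_cylinder {m : Word N → ℝ} (hm : ∀ w, 0 ≤ m w)
    (hadd : ∀ w, m w = ∑ i, m (w ++ [i])) :
    ∃ μ : Measure (Seq N), IsFiniteMeasure μ ∧ ∀ w, μ (cylinder w) = ENNReal.ofReal (m w) := by
  let ρ (n : ℕ) : Measure (Seq N) := ∑ w : Fin n → Fin (N + 1),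
    ENNReal.ofReal (m (List.ofFn w)) • Measure.dirac (padded (List.ofFn w) 0)
  have hρ (n : ℕ) : IsFiniteMeasure (ρ n) := by
    refine ⟨?_⟩
    simp only [ρ, Measure.finsetSum_apply, Measure.smul_apply, measure_univ, smul_eq_mul, mul_one]
    exact ENNReal.sum_lt_top.2 fun _ _ => ENNReal.ofReal_lt_top
  let μ (n : ℕ) : FiniteMeasure (Seq N) := ⟨ρ n, hρ n⟩
  have hint (n : ℕ) (f : Seq N → ℝ) (hf : Continuous f) :
      ∫ ω, f ω ∂(μ n : Measure (Seq N)) = levelSum n fun w => m w * f (padded w 0) := by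
    change ∫ ω, f ω ∂(ρ n) = _
    rw [integral_finsetSum_measure]
    · refine Finset.sum_congr rfl fun w _ => ?_
      rw [integral_smul_measure, integral_dirac, ENNReal.toReal_ofReal (hm _), smul_eq_mul]
    · intro w _
      exact (hf.integrable_of_hasCompactSupport
        (HasCompactSupport.of_compactSpace _)).smul_measure ENNReal.ofReal_ne_top
  have hpre (k n : ℕ) (F : Word N → ℝ) :
      ∫ ω, F (pre k ω) ∂(μ (k + n) : Measure (Seq N)) = levelSum k fun w => m w * F w := by
    rw [hint _ _ (continuous_comp_pre k F), levelSum_add_pre hadd]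
  have hmass (n : ℕ) : (μ n).mass ≤ (m []).toNNReal := by
    have h := hpre 0 n fun _ => 1
    simp only [zero_add, integral_const, smul_eq_mul, mul_one, levelSum_zero] at h
    rw [← NNReal.coe_le_coe, Real.coe_toNNReal _ (hm _), ← h]
    exact le_rfl
  obtain ⟨ν, -, hν⟩ := isCompact_iff_ultrafilter_le_nhds'.1
    (isCompact_setOfPred_finiteMeasure_le_of_compactSpace (Seq N) (m []).toNNReal)
    ((Filter.hyperfilter ℕ).map μ)
    (Filter.mem_map.2 (Filter.Eventually.of_forall hmass))
  have hlim : Filter.Tendsto μ (Filter.hyperfilter ℕ : Filter ℕ) (nhds ν) := hν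
  rw [FiniteMeasure.tendsto_iff_forall_integral_tendsto] at hlim
  refine ⟨ν, inferInstance, fun w => ?_⟩
  have hcont := continuous_comp_pre w.length fun v : Word N => if v = w then (1 : ℝ) else 0
  have h1 := hlim (BoundedContinuousFunction.mkOfCompact ⟨_, hcont⟩)
  have h2 : Filter.Tendsto (fun n => ∫ ω, (if pre w.length ω = w then (1 : ℝ) else 0)
      ∂(μ n : Measure (Seq N))) (Filter.hyperfilter ℕ : Filter ℕ) (nhds (m w)) := by
    refine tendsto_const_nhds.congr' ?_
    refine Filter.Eventually.filter_mono (Nat.hyperfilter_le_atTop) ?_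
    filter_upwards [Filter.eventually_ge_atTop w.length] with n hn
    obtain ⟨n, rfl⟩ := Nat.exists_eq_add_of_le hn
    rw [hpre w.length n fun v : Word N => if v = w then (1 : ℝ) else 0, levelSum]
    rw [Finset.sum_eq_single w.get]
    · simp
    · intro v _ hv
      rw [if_neg, mul_zero]
      intro hvw
      exact hv (List.ofFn_injective (hvw.trans (List.ofFn_get w).symm))
    · simp
  have h3 := tendsto_nhds_unique h1 h2
  simp only [BoundedContinuousFunction.mkOfCompact_apply, ContinuousMap.coe_mk] at h3
  have h4 : (fun ω : Seq N => if pre w.length ω = w then (1 : ℝ) else 0)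
      = (cylinder w).indicator fun _ => 1 := by
    funext ω
    by_cases h : pre w.length ω = w
    · rw [if_pos h, Set.indicator_of_mem (mem_cylinder.2 h)]
    · rw [if_neg h, Set.indicator_of_notMem (fun hω => h (mem_cylinder.1 hω))]
  rw [h4, integral_indicator_const _ (measurableSet_cylinder w), smul_eq_mul, mul_one,
    measureReal_def] at h3
  rw [← h3, ENNReal.ofReal_toReal (measure_ne_top _ _)]

/-! ### Comparison of measures through cylinders -/

theorem cylinder_inter {v w : Word N} (h : v.length ≤ w.length)
    (hne : (cylinder v ∩ cylinder w).Nonempty) : cylinder v ∩ cylinder w = cylinder w := by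
  obtain ⟨ω, hv, hw⟩ := hne
  refine Set.inter_eq_right.2 fun η hη => ?_
  rw [mem_cylinder] at *
  refine Eq.trans (pre_eq_pre_iff.2 ?_) hv
  replace hη := pre_eq_pre_iff.1 (hη.trans hw.symm)
  exact fun k hk => hη k (by omega)

theorem measure_ext_cylinder {μ ν : Measure (Seq N)} [IsFiniteMeasure μ]
    (h : ∀ w, μ (cylinder w) = ν (cylinder w)) : μ = ν := by
  refine ext_of_generate_finite (Set.range (cylinder (N := N))) ?_ ?_ ?_ ?_
  · refine le_antisymm ?_ ?_
    · refine iSup_le fun n => ?_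
      rw [← measurable_iff_comap_le]
      refine @measurable_to_countable' _ _ _ _ (MeasurableSpace.generateFrom _) _ fun i => ?_
      have : (fun ω : Seq N => ω n) ⁻¹' {i}
          = ⋃ w ∈ {w : Word N | w.length = n + 1 ∧ w.getD n 0 = i}, cylinder w := by
        ext ω
        simp only [Set.mem_preimage, Set.mem_singleton_iff, Set.mem_iUnion, mem_cylinder]
        constructor
        · intro hω
          refine ⟨pre (n + 1) ω, ⟨length_pre _ _, ?_⟩, by rw [length_pre]⟩
          rw [List.getD_eq_getElem _ _ (by simp), ← hω]
          simp only [pre, List.getElem_ofFn]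
        · rintro ⟨w, ⟨hl, hw⟩, hω⟩
          rw [← hw, ← hω, List.getD_eq_getElem _ _ (by simp [hl])]
          simp [pre]
      rw [this]
      refine MeasurableSet.biUnion (Set.to_countable _) fun w _ => ?_
      exact MeasurableSpace.measurableSet_generateFrom ⟨w, rfl⟩
    · refine MeasurableSpace.generateFrom_le ?_
      rintro _ ⟨w, rfl⟩
      exact measurableSet_cylinder w
  · rintro _ ⟨v, rfl⟩ _ ⟨w, rfl⟩ hne
    rcases le_total v.length w.length with hl | hl
    · exact ⟨w, (cylinder_inter hl hne).symm⟩
    · rw [Set.inter_comm] at hne ⊢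
      exact ⟨v, (cylinder_inter hl hne).symm⟩
  · rintro _ ⟨w, rfl⟩
    exact h w
  · have : cylinder ([] : Word N) = Set.univ := by
      ext ω; simp [mem_cylinder]
    rw [← this, h]

/-- Domination of the masses of cylinders implies domination of measures. -/
theorem measure_le_of_cylinder {μ ν : Measure (Seq N)} [IsFiniteMeasure μ] [IsFiniteMeasure ν]
    {m n : Word N → ℝ} (hm : ∀ w, 0 ≤ m w) (hmadd : ∀ w, m w = ∑ i, m (w ++ [i]))
    (hnadd : ∀ w, n w = ∑ i, n (w ++ [i])) (hμ : ∀ w, μ (cylinder w) = ENNReal.ofReal (m w))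
    (hν : ∀ w, ν (cylinder w) = ENNReal.ofReal (n w)) (hle : ∀ w, m w ≤ n w) : μ ≤ ν := by
  -- The difference of the masses is nonnegative and additive, hence itself comes from a measure.
  obtain ⟨κ, hκf, hκ⟩ := exists_measure_cylinder (m := fun w => n w - m w)
    (fun w => sub_nonneg.2 (hle w)) fun w => by
      rw [Finset.sum_sub_distrib, ← hmadd, ← hnadd]
  have : μ + κ = ν := measure_ext_cylinder fun w => by
    rw [Measure.add_apply, hμ, hκ, hν, ← ENNReal.ofReal_add (hm w) (sub_nonneg.2 (hle w))]
    ring_nf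
  rw [← this]
  exact Measure.le_add_right le_rfl

theorem measure_countable_eq_zero {μ : Measure (Seq N)} {m : Word N → ℝ}
    (hμ : ∀ w, μ (cylinder w) = ENNReal.ofReal (m w)) {ρ C : ℝ} (hρ0 : 0 ≤ ρ) (hρ1 : ρ < 1)
    (hm : ∀ w, m w ≤ ρ ^ w.length * C) {s : Set (Seq N)} (hs : s.Countable) : μ s = 0 := by
  rw [← Set.biUnion_of_singleton s, measure_biUnion_null_iff hs]
  intro ω _
  have h1 (n : ℕ) : μ {ω} ≤ ENNReal.ofReal (ρ ^ n * C) := by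
    calc μ {ω} ≤ μ (cylinder (pre n ω)) :=
          measure_mono (Set.singleton_subset_iff.2 (mem_cylinder_pre n ω))
      _ ≤ _ := by
          rw [hμ]
          have := hm (pre n ω)
          rw [length_pre] at this
          exact ENNReal.ofReal_le_ofReal this
  have h2 : Filter.Tendsto (fun n => ENNReal.ofReal (ρ ^ n * C)) Filter.atTop (nhds 0) := by
    have := (tendsto_pow_atTop_nhds_zero_of_lt_one hρ0 hρ1).mul_const C
    rw [zero_mul] at this
    simpa using ENNReal.tendsto_ofReal this
  exact le_antisymm (ge_of_tendsto' h2 h1) zero_le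

/-! ### Energy measures of harmonic functions -/

/-- The mass that the energy measure of the harmonic extension of `u` gives to the cell `K_w`. -/
noncomputable def cellMass (u : Fin (N + 1) → ℝ) (w : Word N) : ℝ :=
  (((N : ℝ) + 3) / ((N : ℝ) + 1)) ^ w.length * (2 * Q0 (cellMap w u) (cellMap w u))

theorem cellMass_nonneg (u : Fin (N + 1) → ℝ) (w : Word N) : 0 ≤ cellMass u w :=
  mul_nonneg (by positivity) (mul_nonneg zero_le_two (Q0_nonneg _))

theorem cellMass_eq_sum (u : Fin (N + 1) → ℝ) (w : Word N) :
    cellMass u w = ∑ i, cellMass u (w ++ [i]) := by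
  simp only [cellMass, List.length_append, List.length_singleton, cellMap_append_singleton,
    ← Finset.mul_sum]
  rw [sum_Q0_extMap_self, mul_left_comm 2, ratio_cancel]

theorem cellMass_le (u : Fin (N + 1) → ℝ) (w : Word N) :
    cellMass u w ≤ ratio N ^ w.length * (2 * Q0 u u) := by
  have h := mul_le_mul_of_nonneg_left (Q0_cellMap_le w u)
    (by positivity : 0 ≤ 2 * (((N : ℝ) + 3) / ((N : ℝ) + 1)) ^ w.length)
  have h2 : (((N : ℝ) + 3) / ((N : ℝ) + 1)) ^ w.length *
      (((N : ℝ) + 1) / ((N : ℝ) + 3)) ^ (2 * w.length) = ratio N ^ w.length := by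
    rw [two_mul, pow_add, ← mul_assoc, ← mul_pow, div_mul_div_cancel₀ (by positivity),
      div_self (by positivity), one_pow, one_mul, ratio]
  rw [cellMass, ← h2]
  linarith

theorem exists_cylinderMeasure (u : Fin (N + 1) → ℝ) :
    ∃ μ : Measure (Seq N), IsFiniteMeasure μ ∧
      ∀ w, μ (cylinder w) = ENNReal.ofReal (cellMass u w) :=
  exists_measure_cylinder (cellMass_nonneg u) (cellMass_eq_sum u)

/-- The measure on sequences whose image is the energy measure of the harmonic extension of `u`. -/
noncomputable def cylinderMeasure (u : Fin (N + 1) → ℝ) : Measure (Seq N) :=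
  (exists_cylinderMeasure u).choose

instance (u : Fin (N + 1) → ℝ) : IsFiniteMeasure (cylinderMeasure u) :=
  (exists_cylinderMeasure u).choose_spec.1

theorem cylinderMeasure_cylinder (u : Fin (N + 1) → ℝ) (w : Word N) :
    cylinderMeasure u (cylinder w) = ENNReal.ofReal (cellMass u w) :=
  (exists_cylinderMeasure u).choose_spec.2 w

theorem eventually_abs_vertex_sub_le (g : C(gasket p, ℝ)) {ε : ℝ} (hε : 0 < ε) :
    ∀ᶠ n in Filter.atTop, ∀ (ω : Seq N) (i : Fin (N + 1)),
      |g (vertex p (pre n ω) i) - g (code p ω)| ≤ ε := by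
  have hu := CompactSpace.uniformContinuous_of_continuous g.continuous
  obtain ⟨δ, hδ, h⟩ := Metric.uniformContinuous_iff.1 hu ε hε
  filter_upwards [(tendsto_half_pow_mul (Metric.diam (simplex p))).eventually_lt_const hδ]
    with n hn ω i
  exact (h ((dist_vertex_le p n ω i).trans_lt hn)).le

theorem cellValues_mul (f g : C(gasket p, ℝ)) (w : Word N) :
    cellValues p (f * g : C(gasket p, ℝ)) w = cellValues p f w * cellValues p g w :=
  funext fun _ => ContinuousMap.mul_apply f g _

theorem cellValues_sq (f : C(gasket p, ℝ)) (w : Word N) :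
    cellValues p (f ^ 2 : C(gasket p, ℝ)) w = cellValues p f w ^ 2 :=
  funext fun _ => ContinuousMap.pow_apply f 2 _

theorem two_mul_energyAt_sub {u : Fin (N + 1) → ℝ} {h : C(gasket p, ℝ)}
    (hh : HasHarmonicValues p u h) (g : C(gasket p, ℝ)) (n : ℕ) :
    2 * energyAt p n h (h * g : C(gasket p, ℝ)) - energyAt p n (h ^ 2 : C(gasket p, ℝ)) g
      = levelSum n fun w => ∑ i, (((N : ℝ) + 3) / ((N : ℝ) + 1)) ^ n *
        (∑ j, (cellMap w u i - cellMap w u j) ^ 2) * g (vertex p w i) := by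
  rw [energyAt, energyAt, mul_left_comm, ← mul_sub, ← levelSum_mul n 2, ← levelSum_sub,
    ← levelSum_mul n]
  refine levelSum_congr fun w _ => ?_
  rw [cellValues_mul, cellValues_sq, two_mul_Q0_mul_sub, hh w, Finset.mul_sum]
  exact Finset.sum_congr rfl fun i _ => by rw [mul_assoc]; rfl

theorem sum_sq_eq_cellMass (u : Fin (N + 1) → ℝ) (w : Word N) :
    ∑ i, (((N : ℝ) + 3) / ((N : ℝ) + 1)) ^ w.length *
      (∑ j, (cellMap w u i - cellMap w u j) ^ 2) = cellMass u w := by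
  rw [← Finset.mul_sum, cellMass, Q0]
  simp only [sq]
  ring

/-- The expression at level n is a Riemann sum for g: its weights within a cell K_w add up to
`cellMass u w`, and uniform continuity allows g to be evaluated at one vertex only. -/
theorem tendsto_two_mul_energyAt_sub {u : Fin (N + 1) → ℝ} {h : C(gasket p, ℝ)}
    (hh : HasHarmonicValues p u h) (g : C(gasket p, ℝ)) :
    Filter.Tendsto (fun n => 2 * energyAt p n h (h * g : C(gasket p, ℝ))
      - energyAt p n (h ^ 2 : C(gasket p, ℝ)) g) Filter.atTop
      (nhds (∫ ω, g (code p ω) ∂(cylinderMeasure u))) := by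
  have h1 := tendsto_levelSum_integral (μ := cylinderMeasure u) (cellMass_nonneg u)
    (cylinderMeasure_cylinder u) (g := fun ω => g (code p ω))
    (G := fun w => g (vertex p w 0))
    ((g.continuous.comp (continuous_code p)).integrable_of_hasCompactSupport
      (HasCompactSupport.of_compactSpace _))
    fun ε hε => (eventually_abs_vertex_sub_le g hε).mono fun n hn ω => hn ω 0
  have h2 : Filter.Tendsto (fun n => (2 * energyAt p n h (h * g : C(gasket p, ℝ))
      - energyAt p n (h ^ 2 : C(gasket p, ℝ)) g)
      - levelSum n fun w => cellMass u w * g (vertex p w 0)) Filter.atTop (nhds 0) := by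
    rw [Metric.tendsto_atTop']
    intro ε hε
    -- Moving from vertex i to vertex 0 through a point of the cell costs two errors, against the
    -- total mass `cellMass u []`; the 1 keeps the denominator positive.
    have hM : 0 < 2 * cellMass u [] + 1 := by
      have := cellMass_nonneg u []
      linarith
    obtain ⟨n, hn⟩ := Filter.eventually_atTop.1
      (eventually_abs_vertex_sub_le g (ε := ε / (2 * cellMass u [] + 1)) (by positivity))
    refine ⟨n, fun k hk => ?_⟩
    rw [dist_zero_right, two_mul_energyAt_sub hh, ← levelSum_sub, Real.norm_eq_abs]
    have htot (k : ℕ) : levelSum k (fun w => cellMass u w) = cellMass u [] := by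
      have := levelSum_add_pre (cellMass_eq_sum u) 0 k fun _ => 1
      simpa using this
    have hb : levelSum k (fun w => |∑ i, (((N : ℝ) + 3) / ((N : ℝ) + 1)) ^ k *
        (∑ j, (cellMap w u i - cellMap w u j) ^ 2) * g (vertex p w i)
        - cellMass u w * g (vertex p w 0)|)
        ≤ levelSum k fun w => 2 * (ε / (2 * cellMass u [] + 1)) * cellMass u w := by
      refine levelSum_mono fun w hw => ?_
      rw [← hw, ← sum_sq_eq_cellMass, Finset.sum_mul, ← Finset.sum_sub_distrib, Finset.mul_sum]
      refine (Finset.abs_sum_le_sum_abs _ _).trans (Finset.sum_le_sum fun i _ => ?_)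
      have hnn : 0 ≤ (((N : ℝ) + 3) / ((N : ℝ) + 1)) ^ w.length *
          (∑ j, (cellMap w u i - cellMap w u j) ^ 2) :=
        mul_nonneg (by positivity) (Finset.sum_nonneg fun _ _ => sq_nonneg _)
      rw [← mul_sub, abs_mul, abs_of_nonneg hnn, mul_comm]
      refine mul_le_mul_of_nonneg_right ?_ hnn
      have e1 := hn k hk.le (padded w 0) i
      have e2 := hn k hk.le (padded w 0) 0
      rw [← hw, pre_padded] at e1 e2
      rw [abs_sub_comm] at e2
      have := abs_sub_le (g (vertex p w i)) (g (code p (padded w 0))) (g (vertex p w 0))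
      linarith
    refine ((abs_levelSum_le _ _).trans hb).trans_lt ?_
    rw [levelSum_mul, htot, mul_div_assoc', div_mul_eq_mul_div, div_lt_iff₀ hM]
    nlinarith
  simpa using h2.add h1

/-- The image of `cylinderMeasure u` is an energy measure of the harmonic extension of `u`. -/
theorem HasHarmonicValues.isEnergyMeasure {u : Fin (N + 1) → ℝ} {h : C(gasket p, ℝ)}
    (hh : HasHarmonicValues p u h) :
    IsEnergyMeasure p h ((cylinderMeasure u).map (code p)) := by
  refine ⟨inferInstance, fun g hg => ?_⟩
  rw [integral_map (continuous_code p).measurable.aemeasurable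
    g.continuous.aestronglyMeasurable]
  refine tendsto_nhds_unique (tendsto_two_mul_energyAt_sub hh g) ?_
  have hd := hh.mem_domain
  refine ((tendsto_energyAt hd (mul_mem_domain hd hg)).const_mul 2).sub
    (tendsto_energyAt ?_ hg)
  rw [sq]
  exact mul_mem_domain hd hd

/-! ### Uniqueness of energy measures -/

/-- The domain of the energy form as an algebra. -/
noncomputable def domainAlgebra (p : Fin (N + 1) → Space N) : Subalgebra ℝ C(gasket p, ℝ) where
  carrier := domain p
  mul_mem' := mul_mem_domain
  add_mem' := add_mem_domain
  algebraMap_mem' c := const_mem_domain c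

theorem domainAlgebra_separatesPoints (hp : AffineIndependent ℝ p) :
    (domainAlgebra p).SeparatesPoints := by
  intro x y hxy
  obtain ⟨ω, rfl⟩ := surjective_code p x
  obtain ⟨ω', rfl⟩ := surjective_code p y
  obtain ⟨u, hu⟩ : ∃ u, harmonicValue u ω ≠ harmonicValue u ω' := by
    by_contra! hc
    exact hxy (Subtype.ext (coding_eq_of_harmonicValue_eq p hc))
  obtain ⟨h, hh, hval⟩ := exists_harmonic hp u
  exact ⟨h, ⟨h, hh.mem_domain, rfl⟩, by rwa [hval, hval]⟩

theorem continuous_integral_continuousMap (ν : Measure (gasket p)) [IsFiniteMeasure ν] :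
    Continuous fun g : C(gasket p, ℝ) => ∫ x, g x ∂ν := by
  refine (LipschitzWith.of_dist_le_mul (K := ⟨ν.real Set.univ, measureReal_nonneg⟩)
    fun f g => ?_).continuous
  have hi (f : C(gasket p, ℝ)) : Integrable f ν :=
    f.continuous.integrable_of_hasCompactSupport (HasCompactSupport.of_compactSpace _)
  rw [dist_eq_norm, ← integral_sub (hi f) (hi g), mul_comm]
  refine norm_integral_le_of_norm_le_const (Filter.Eventually.of_forall fun x => ?_)
  rw [← dist_eq_norm]
  exact ContinuousMap.dist_apply_le_dist x

/-- By Stone–Weierstrass the domain is uniformly dense in C(K), so the prescribed integrals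
determine a finite measure. -/
theorem IsEnergyMeasure.unique (hp : AffineIndependent ℝ p) {f : C(gasket p, ℝ)}
    {ν ν' : Measure (gasket p)} (hν : IsEnergyMeasure p f ν) (hν' : IsEnergyMeasure p f ν') :
    ν = ν' := by
  have := hν.1
  have := hν'.1
  have hclosed : IsClosed {g : C(gasket p, ℝ) | ∫ x, g x ∂ν = ∫ x, g x ∂ν'} :=
    isClosed_eq (continuous_integral_continuousMap ν) (continuous_integral_continuousMap ν')
  have hsub : (domainAlgebra p : Set C(gasket p, ℝ))
      ⊆ {g : C(gasket p, ℝ) | ∫ x, g x ∂ν = ∫ x, g x ∂ν'} :=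
    fun g hg => (hν.2 g hg).trans (hν'.2 g hg).symm
  have hdense := ContinuousMap.subalgebra_topologicalClosure_eq_top_of_separatesPoints
    (domainAlgebra p) (domainAlgebra_separatesPoints hp)
  refine ext_of_forall_integral_eq_of_IsFiniteMeasure fun g => ?_
  have hg : g.toContinuousMap ∈ (domainAlgebra p).topologicalClosure := by
    rw [hdense]; trivial
  exact closure_minimal hsub hclosed hg

theorem HasHarmonicValues.energyMeasure_eq (hp : AffineIndependent ℝ p) {u : Fin (N + 1) → ℝ}
    {h : C(gasket p, ℝ)} (hh : HasHarmonicValues p u h) :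
    energyMeasure p h = (cylinderMeasure u).map (code p) :=
  IsEnergyMeasure.unique hp (Classical.epsilon_spec ⟨_, hh.isEnergyMeasure⟩) hh.isEnergyMeasure

theorem hasHarmonicValues_harmonicExtension (hp : AffineIndependent ℝ p) (u : Fin (N + 1) → ℝ) :
    HasHarmonicValues p u (harmonicExtension p u) := by
  obtain ⟨h, hh, -⟩ := exists_harmonic hp u
  have : IsHarmonicExtension p u (harmonicExtension p u) :=
    Classical.epsilon_spec ⟨h, hh.isHarmonicExtension⟩
  rwa [hh.eq_of_isHarmonicExtension this]

theorem exists_hasHarmonicValues_of_mem_harmonic (hp : AffineIndependent ℝ p) {h : C(gasket p, ℝ)}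
    (hh : h ∈ harmonic p) : ∃ u, HasHarmonicValues p u h := by
  obtain ⟨f, hf, -⟩ := exists_harmonic hp fun i => h (vertex p [] i)
  refine ⟨fun i => h (vertex p [] i), ?_⟩
  have e := hf.eq_of_isHarmonicExtension (f := h) ⟨hh, fun i => rfl⟩
  exact e ▸ hf

theorem kusuokaMeasure_eq (hp : AffineIndependent ℝ p) :
    kusuokaMeasure p = ∑ k, (cylinderMeasure (Pi.single k 1)).map (code p) :=
  Finset.sum_congr rfl fun k _ =>
    (hasHarmonicValues_harmonicExtension hp (Pi.single k 1)).energyMeasure_eq hp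

/-! ### Masses of cells -/

theorem cell_eq_image (p : Fin (N + 1) → Space N) (w : Word N) :
    cell p w = code p '' cylinder w := by
  ext x
  constructor
  · rintro ⟨y, hy, hyx⟩
    obtain ⟨η, hη⟩ := surjective_code p ⟨y, hy⟩
    refine ⟨appendSeq w η, pre_appendSeq w η, Subtype.ext ?_⟩
    rw [← hyx]
    change coding p (appendSeq w η) = _
    rw [coding_appendSeq]
    exact congrArg _ (congrArg Subtype.val hη)
  · rintro ⟨ω, hω, rfl⟩
    refine ⟨coding p (dropSeq w.length ω), coding_mem_gasket p _, ?_⟩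
    have := coding_eq_psi p w.length ω
    rw [mem_cylinder.1 hω] at this
    exact this.symm

theorem measurableSet_cell (p : Fin (N + 1) → Space N) (w : Word N) : MeasurableSet (cell p w) := by
  rw [cell_eq_image]
  exact ((isClopen_cylinder w).isClosed.isCompact.image (continuous_code p)).isClosed.measurableSet

theorem cell_append_subset (p : Fin (N + 1) → Space N) (v w : Word N) :
    cell p (v ++ w) ⊆ cell p v := by
  rw [cell_eq_image, cell_eq_image]
  refine Set.image_mono fun ω hω => ?_
  rw [mem_cylinder, List.length_append, pre_add] at hω
  exact List.append_inj_left hω (length_pre _ _)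

theorem preimage_cell_subset (hp : AffineIndependent ℝ p) (w : Word N) :
    code p ⁻¹' cell p w ⊆ cylinder w ∪ eventuallyConst N := by
  intro ω hω
  rw [Set.mem_preimage, cell_eq_image] at hω
  obtain ⟨ω', hω', hc⟩ := hω
  rcases eq_or_ne ω' ω with rfl | hne
  · exact Or.inl hω'
  · obtain ⟨n, -, -, h⟩ := exists_of_coding_eq hp (congrArg Subtype.val hc) hne
    refine Or.inr ⟨n + 1, ω' n, fun k hk => ?_⟩
    obtain ⟨l, rfl⟩ := Nat.exists_eq_add_of_le hk
    have := congrFun h l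
    rwa [tail, dropSeq, ← add_assoc, Nat.add_right_comm n l 1] at this

/-- The preimage of a cell exceeds its cylinder only by eventually constant sequences; these are
countably many, and points are null because cylinder masses decay geometrically. -/
theorem map_cylinderMeasure_cell (hp : AffineIndependent ℝ p) (u : Fin (N + 1) → ℝ) (w : Word N) :
    (cylinderMeasure u).map (code p) (cell p w) = ENNReal.ofReal (cellMass u w) := by
  rw [Measure.map_apply (continuous_code p).measurable (measurableSet_cell p w),
    ← cylinderMeasure_cylinder]
  refine le_antisymm ?_ (measure_mono ?_)
  · refine (measure_mono (preimage_cell_subset hp w)).trans ((measure_union_le _ _).trans ?_)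
    rw [measure_countable_eq_zero (cylinderMeasure_cylinder u) ratio_pos.le ratio_lt_one
      (cellMass_le u) countable_eventuallyConst, add_zero]
  · rw [cell_eq_image]
    exact Set.subset_preimage_image _ _

theorem kusuokaMeasure_cell (hp : AffineIndependent ℝ p) (w : Word N) :
    kusuokaMeasure p (cell p w)
      = ENNReal.ofReal (∑ k : Fin (N + 1), cellMass (Pi.single k 1) w) := by
  rw [kusuokaMeasure_eq hp, Measure.finsetSum_apply,
    ENNReal.ofReal_sum_of_nonneg fun _ _ => cellMass_nonneg _ _]
  exact Finset.sum_congr rfl fun k _ => map_cylinderMeasure_cell hp _ w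

/-- Expand u in the standard basis and apply Cauchy–Schwarz to each difference of vertex values. -/
theorem cellMass_le_sum (u : Fin (N + 1) → ℝ) (w : Word N) :
    cellMass u w ≤ (∑ k, u k ^ 2) * ∑ k : Fin (N + 1), cellMass (Pi.single k 1) w := by
  have hu (i) : cellMap w u i = ∑ k, u k * cellMap w (Pi.single k 1) i := by
    conv_lhs => rw [← Finset.univ_sum_single u]
    rw [map_sum, Finset.sum_apply]
    refine Finset.sum_congr rfl fun k _ => ?_
    have : (Pi.single k (u k) : Fin (N + 1) → ℝ) = u k • Pi.single k 1 := by
      rw [← Pi.single_smul, smul_eq_mul, mul_one]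
    rw [this, map_smul, Pi.smul_apply, smul_eq_mul]
  have h (i j) : (cellMap w u i - cellMap w u j) * (cellMap w u i - cellMap w u j)
      ≤ (∑ k, u k ^ 2) * ∑ k, (cellMap w (Pi.single k 1) i - cellMap w (Pi.single k 1) j) ^ 2 := by
    rw [← sq, hu, hu, ← Finset.sum_sub_distrib]
    simp only [← mul_sub]
    exact Finset.sum_mul_sq_le_sq_mul_sq _ _ _
  have hQ : Q0 (cellMap w u) (cellMap w u) ≤ (∑ k, u k ^ 2) *
      ∑ k : Fin (N + 1), Q0 (cellMap w (Pi.single k 1)) (cellMap w (Pi.single k 1)) := by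
    have := Finset.sum_le_sum fun i (_ : i ∈ Finset.univ) =>
      Finset.sum_le_sum fun j (_ : j ∈ Finset.univ) => h i j
    simp only [← Finset.mul_sum] at this
    have e : ∑ k : Fin (N + 1), Q0 (cellMap w (Pi.single k 1)) (cellMap w (Pi.single k 1))
        = 1 / 2 * ∑ i, ∑ j, ∑ k,
          (cellMap w (Pi.single k 1) i - cellMap w (Pi.single k 1) j) ^ 2 := by
      simp only [Q0, ← Finset.mul_sum, ← sq]
      rw [Finset.sum_comm]
      congr 1
      exact Finset.sum_congr rfl fun i _ => Finset.sum_comm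
    rw [e, Q0]
    linarith
  simp only [cellMass, ← Finset.mul_sum]
  have := mul_le_mul_of_nonneg_left hQ
    (by positivity : 0 ≤ 2 * (((N : ℝ) + 3) / ((N : ℝ) + 1)) ^ w.length)
  linarith

theorem sum_cellMass_pos (hN : 2 ≤ N) (w : Word N) :
    0 < ∑ k : Fin (N + 1), cellMass (Pi.single k 1) w := by
  obtain ⟨u, hu⟩ := cellMap_surjective w (Pi.single ⟨0, by omega⟩ 1)
  have h1 : 0 < cellMass u w := by
    refine mul_pos (by positivity) (mul_pos two_pos ?_)
    have := sq_sub_le_Q0 (cellMap w u) ⟨0, by omega⟩ ⟨1, by omega⟩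
    rw [hu] at this ⊢
    refine lt_of_lt_of_le ?_ this
    simp
  have h2 := h1.trans_le (cellMass_le_sum u w)
  exact pos_of_mul_pos_right h2 (Finset.sum_nonneg fun _ _ => sq_nonneg _)

/-- The bound `cellMass_le_sum` on cylinders upgrades to an inequality of measures on sequences,
which passes to the images. -/
theorem map_cylinderMeasure_absolutelyContinuous (hp : AffineIndependent ℝ p)
    (u : Fin (N + 1) → ℝ) : (cylinderMeasure u).map (code p) ≪ kusuokaMeasure p := by
  have hc : 0 ≤ ∑ k, u k ^ 2 := Finset.sum_nonneg fun _ _ => sq_nonneg _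
  have hle : cylinderMeasure u ≤ ENNReal.ofReal (∑ k, u k ^ 2) •
      ∑ k : Fin (N + 1), cylinderMeasure (Pi.single k 1) := by
    have : IsFiniteMeasure (ENNReal.ofReal (∑ k, u k ^ 2) •
        ∑ k : Fin (N + 1), cylinderMeasure (Pi.single k (1 : ℝ))) :=
      Measure.smul_finite _ ENNReal.ofReal_ne_top
    refine measure_le_of_cylinder (cellMass_nonneg u) (cellMass_eq_sum u)
      (n := fun w => (∑ k, u k ^ 2) * ∑ k : Fin (N + 1), cellMass (Pi.single k 1) w)
      (fun w => ?_) (cylinderMeasure_cylinder u) (fun w => ?_) (cellMass_le_sum u)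
    · rw [← Finset.mul_sum, Finset.sum_comm]
      simp only [← cellMass_eq_sum]
    · rw [Measure.smul_apply, Measure.finsetSum_apply, smul_eq_mul, ENNReal.ofReal_mul hc,
        ENNReal.ofReal_sum_of_nonneg fun _ _ => cellMass_nonneg _ _]
      simp only [cylinderMeasure_cylinder]
  refine Measure.AbsolutelyContinuous.mk fun s hs h0 => ?_
  rw [kusuokaMeasure_eq hp, Measure.finsetSum_apply, Finset.sum_eq_zero_iff] at h0
  rw [Measure.map_apply (continuous_code p).measurable hs]
  refine le_antisymm ((hle _).trans (le_of_eq ?_)) zero_le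
  rw [Measure.smul_apply, Measure.finsetSum_apply]
  refine (congrArg _ (Finset.sum_eq_zero fun k hk => ?_)).trans (smul_zero _)
  rw [← Measure.map_apply (continuous_code p).measurable hs]
  exact h0 k hk

theorem isFiniteMeasure_kusuokaMeasure (hp : AffineIndependent ℝ p) :
    IsFiniteMeasure (kusuokaMeasure p) := by
  rw [kusuokaMeasure_eq hp]
  infer_instance

/-! ### Infimum of the ratios -/

theorem exists_cellMass_le (hN : 2 ≤ N) (u : Fin (N + 1) → ℝ) (w : Word N) {δ : ℝ} (hδ : 0 < δ) :
    ∃ w' : Word N, cellMass u (w ++ w')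
      ≤ δ * ∑ k : Fin (N + 1), cellMass (Pi.single k 1) (w ++ w') := by
  obtain ⟨v, hv⟩ := exists_forall_exists_Q0_cellMap_le hN (cellMap w u)
  obtain ⟨y, rfl⟩ := cellMap_surjective w v
  have hM : 0 ≤ ∑ k, y k ^ 2 := Finset.sum_nonneg fun _ _ => sq_nonneg _
  -- The denominator absorbs the constant with which the Kusuoka masses dominate those of y; the 1
  -- covers y = 0.
  obtain ⟨w', hw'⟩ := hv (δ / (∑ k, y k ^ 2 + 1)) (by positivity)
  refine ⟨w', ?_⟩
  rw [← cellMap_append, ← cellMap_append] at hw'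
  have h1 : cellMass u (w ++ w') ≤ δ / (∑ k, y k ^ 2 + 1) * cellMass y (w ++ w') := by
    have := mul_le_mul_of_nonneg_left hw'
      (by positivity : 0 ≤ 2 * (((N : ℝ) + 3) / ((N : ℝ) + 1)) ^ (w ++ w').length)
    rw [cellMass, cellMass]
    linarith
  have h2 := cellMass_le_sum y (w ++ w')
  have h3 : 0 ≤ ∑ k : Fin (N + 1), cellMass (Pi.single k 1) (w ++ w') :=
    Finset.sum_nonneg fun _ _ => cellMass_nonneg _ _
  refine h1.trans ?_
  rw [div_mul_eq_mul_div, div_le_iff₀ (by positivity), mul_assoc]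
  refine mul_le_mul_of_nonneg_left (h2.trans ?_) hδ.le
  nlinarith

theorem iInf_ratio_eq_zero (hN : 2 ≤ N) (hp : AffineIndependent ℝ p) (u : Fin (N + 1) → ℝ)
    (w : Word N) :
    ⨅ w' : Word N, (cylinderMeasure u).map (code p) (cell p (w ++ w'))
      / kusuokaMeasure p (cell p (w ++ w')) = 0 := by
  refine le_antisymm (ENNReal.le_of_forall_pos_le_add fun δ hδ _ => ?_) zero_le
  obtain ⟨w', hw'⟩ := exists_cellMass_le hN u w (NNReal.coe_pos.2 hδ)
  refine iInf_le_of_le w' ?_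
  rw [map_cylinderMeasure_cell hp, kusuokaMeasure_cell hp, zero_add]
  refine ENNReal.div_le_of_le_mul ?_
  rw [← ENNReal.ofReal_coe_nnreal, ← ENNReal.ofReal_mul (NNReal.coe_nonneg δ)]
  exact ENNReal.ofReal_le_ofReal hw'

/-- The essential infimum of a density is at most the ratio of the masses. -/
theorem essInf_rnDeriv_le {X : Type*} [MeasurableSpace X] {μ κ : Measure X} [IsFiniteMeasure μ]
    [IsFiniteMeasure κ] (h : μ ≪ κ) {s t : Set X} (hts : t ⊆ s) (ht : κ t ≠ 0) :
    essInf (μ.rnDeriv κ) (κ.restrict s) ≤ μ t / κ t := by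
  rw [ENNReal.le_div_iff_mul_le (Or.inl ht) (Or.inl (measure_ne_top _ _)),
    ← Measure.setLIntegral_rnDeriv h, ← setLIntegral_const]
  refine lintegral_mono_ae ?_
  exact (Measure.absolutelyContinuous_of_le (Measure.restrict_mono hts le_rfl)).ae_le
    (ae_essInf_le)

end SierpinskiGasket
open SierpinskiGasket in
theorem theorem5p1 (N : ℕ) (hN : 2 ≤ N) (p : Fin (N + 1) → EuclideanSpace ℝ (Fin N))
    (hp : AffineIndependent ℝ p) :
    -- the harmonic extensions, the energy measures and the ratios below are well defined
    (∀ u : Fin (N + 1) → ℝ, ∃! h : C(gasket p, ℝ), IsHarmonicExtension p u h) ∧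
    (∀ h ∈ harmonic p, ∃! ν : Measure (gasket p), IsEnergyMeasure p h ν) ∧
    (∀ w : Word N, 0 < kusuokaMeasure p (cell p w) ∧ kusuokaMeasure p (cell p w) < ∞) ∧
    (∀ h ∈ harmonic p, energyMeasure p h ≪ kusuokaMeasure p) ∧
    -- the result
    ∀ h ∈ harmonic p, ∀ w : Word N,
      (⨅ w' : Word N,
        energyMeasure p h (cell p (w ++ w')) / kusuokaMeasure p (cell p (w ++ w'))) = 0 ∧
      essInf ((energyMeasure p h).rnDeriv (kusuokaMeasure p))
        ((kusuokaMeasure p).restrict (cell p w)) = 0 := by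
  have hpos (w : Word N) : 0 < kusuokaMeasure p (cell p w) := by
    rw [kusuokaMeasure_cell hp]
    exact ENNReal.ofReal_pos.2 (sum_cellMass_pos hN w)
  have := isFiniteMeasure_kusuokaMeasure hp
  refine ⟨fun u => ?_, fun h hh => ?_, fun w => ⟨hpos w, measure_lt_top _ _⟩, fun h hh => ?_,
    fun h hh w => ?_⟩
  · obtain ⟨h, hh, -⟩ := exists_harmonic hp u
    exact ⟨h, hh.isHarmonicExtension, fun f hf => hh.eq_of_isHarmonicExtension hf⟩
  · obtain ⟨u, hu⟩ := exists_hasHarmonicValues_of_mem_harmonic hp hh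
    exact ⟨_, hu.isEnergyMeasure, fun ν hν => hν.unique hp hu.isEnergyMeasure⟩
  · obtain ⟨u, hu⟩ := exists_hasHarmonicValues_of_mem_harmonic hp hh
    rw [hu.energyMeasure_eq hp]
    exact map_cylinderMeasure_absolutelyContinuous hp u
  · obtain ⟨u, hu⟩ := exists_hasHarmonicValues_of_mem_harmonic hp hh
    rw [hu.energyMeasure_eq hp]
    have hinf := iInf_ratio_eq_zero hN hp u w
    -- The essential infimum over K_w is at most the ratio of masses on each subcell, hence at most
    -- their infimum, which is 0.
    refine ⟨hinf, le_antisymm (hinf ▸ le_iInf fun w' => ?_) zero_le⟩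
    exact essInf_rnDeriv_le (map_cylinderMeasure_absolutelyContinuous hp u)
      (cell_append_subset p w w') (hpos _).ne'
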